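/- Let $n\in\{1,2,\dots\}$, $p\in[1,\infty)$, $q\in(0,p]$ and $\gamma\in\mathbb R\setminus\{0\}$. A \emph{ball Banach function space} $X$ on $\mathbb R^n$ is a Banach space of (equivalence classes of) measurable functions $f:\mathbb R^n\to\mathbb C$ whose norm $\|\cdot\|_X$ is defined, with values in $[0,\infty]$, for all measurable functions, such that $X=\{f:\|f\|_X<\infty\}$ and: (i) $\|f\|_X=0$ implies $f=0$ a.e.; (ii) $|g|\le|f|$ a.e. implies $\|g\|_X\le\|f\|_X$; (iii) $0\le f_m\uparrow f$ a.e. implies $\|f_m\|_X\uparrow\|f\|_X$; (iv) $\mathbf 1_B\in X$ for every ball $B$; (v) $\|f+g\|_X\le\|f\|_X+\|g\|_X$ for $f,g\in X$; (vi) for every ball $B$ there is $C_{(B)}\in(0,\infty)$ with $\int_B|f|\,dx\le C_{(B)}\|f\|_X$ for all $f\in X$. For $s\in(0,\infty)$ let $X^s:=\{f:|f|^s\in X\}$ with $\|f\|_{X^s}:=\||f|^s\|_X^{1/s}$, and let $X'$ be the associate space, with norm $\|f\|_{X'}:=\sup\{\|fg\|_{L^1(\mathbb R^n)}:\|g\|_X=1\}$.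 Let $\mathcal M(f)(x):=\sup_{B\ni x}\frac1{|B|}\int_B|f(y)|\,dy$ be the Hardy--Littlewood maximal operator, the supremum being over all balls $B$ containing $x$. For $f:\mathbb R^n\to\mathbb C$ and $\lambda\in(0,\infty)$ put $$E_{\lambda,\gamma/q}[f]:=\Big\{(x,y)\in\mathbb R^n\times\mathbb R^n:\ x\ne y,\ \frac{|f(x)-f(y)|}{|x-y|^{1+\gamma/q}}>\lambda\Big\}.$$ Then there is a function $C=C_{p,q,\gamma,n}:[0,\infty)^2\to(0,\infty)$, continuous and increasing in each of its two arguments, such that the following holds. Let $X$ be any ball Banach function space on $\mathbb R^n$ for which $X^{1/p}$ is also a ball Banach function space and $\mathcal M$ is bounded on both $X$ and $(X^{1/p})'$, with operator norms $\|\mathcal M\|_{X\to X}$ and $\|\mathcal M\|_{(X^{1/p})'\to(X^{1/p})'}$. Then, for every $f\in C^1(\mathbb R^n)$ such that $|\nabla f|$ has compact support, $$\sup_{\lambda\in(0,\infty)}\lambda\left\|\left[\int_{\mathbb R^n}\mathbf 1_{E_{\lambda,\gamma/q}[f]}(\cdot,y)\,|\cdot-y|^{\gamma-n}\,dy\right]^{1/q}\right\|_X\le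 C\big(\|\mathcal M\|_{X\to X},\|\mathcal M\|_{(X^{1/p})'\to(X^{1/p})'}\big)\,\big\|\,|\nabla f|\,\big\|_X .$$ -/

import Mathlib

open MeasureTheory Filter Topology
open scoped ENNReal NNReal

noncomputable section

namespace BallSpace

/-- The Euclidean space `ℝⁿ`. -/
abbrev Rn (n : ℕ) : Type := EuclideanSpace ℝ (Fin n)

/-- Ball quasi-Banach function spaces on `ℝⁿ`. Such a space `X` is given by its quasi-norm `ρ`,
which makes sense on all (Lebesgue) measurable functions `ℝⁿ → ℂ` and takes values in `[0, ∞]`;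
`X` is the set of the measurable `f` with `ρ f < ∞`, functions that are equal almost everywhere
being identified. The values of `ρ` on non-measurable functions play no role. Completeness of `X`
is a consequence of `mono` and `fatou` and is therefore not listed. -/
structure IsBallQuasiBanach {n : ℕ} (ρ : (Rn n → ℂ) → ℝ≥0∞) : Prop where
  smul : ∀ (c : ℂ) (f : Rn n → ℂ), AEMeasurable f volume →
    ρ (fun x => c * f x) = ‖c‖ₑ * ρ f
  quasi_triangle : ∃ K : ℝ≥0, ∀ f g : Rn n → ℂ, AEMeasurable f volume → AEMeasurable g volume →
    ρ f < ∞ → ρ g < ∞ → ρ (fun x => f x + g x) ≤ K * (ρ f + ρ g)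
  eq_zero : ∀ f : Rn n → ℂ, AEMeasurable f volume → ρ f = 0 → ∀ᵐ x ∂volume, f x = 0
  mono : ∀ f g : Rn n → ℂ, AEMeasurable f volume → AEMeasurable g volume →
    (∀ᵐ x ∂volume, ‖g x‖ ≤ ‖f x‖) → ρ g ≤ ρ f
  fatou : ∀ (u : ℕ → Rn n → ℝ) (f : Rn n → ℝ),
    (∀ m, AEMeasurable (u m) volume) → AEMeasurable f volume →
    (∀ᵐ x ∂volume, (∀ m, 0 ≤ u m x) ∧ Monotone (fun m => u m x) ∧
      Tendsto (fun m => u m x) atTop (𝓝 (f x))) →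
    Monotone (fun m => ρ (fun x => (u m x : ℂ))) ∧
      Tendsto (fun m => ρ (fun x => (u m x : ℂ))) atTop (𝓝 (ρ (fun x => (f x : ℂ))))
  ball_mem : ∀ (c : Rn n) (r : ℝ), 0 < r →
    ρ ((Metric.ball c r).indicator (fun _ => (1 : ℂ))) < ∞

/-- Ball Banach function spaces on `ℝⁿ`. -/
structure IsBallBanach {n : ℕ} (ρ : (Rn n → ℂ) → ℝ≥0∞) : Prop extends
    IsBallQuasiBanach ρ where
  triangle : ∀ f g : Rn n → ℂ, AEMeasurable f volume → AEMeasurable g volume →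
    ρ f < ∞ → ρ g < ∞ → ρ (fun x => f x + g x) ≤ ρ f + ρ g
  integral_ball_le : ∀ (c : Rn n) (r : ℝ), 0 < r → ∃ C : ℝ≥0, 0 < C ∧
    ∀ f : Rn n → ℂ, AEMeasurable f volume → ρ f < ∞ →
      ∫⁻ x in Metric.ball c r, ‖f x‖ₑ ≤ C * ρ f

/-- The quasi-norm `‖|f|^s‖_X^{1/s}` of the `s`-convexification `X^s`. -/
def convexification {n : ℕ} (ρ : (Rn n → ℂ) → ℝ≥0∞) (s : ℝ) : (Rn n → ℂ) → ℝ≥0∞ :=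
  fun f => (ρ (fun x => ((‖f x‖ ^ s : ℝ) : ℂ))) ^ (1 / s)

/-- The norm of the associate space (Köthe dual) `X'`. -/
def associate {n : ℕ} (ρ : (Rn n → ℂ) → ℝ≥0∞) : (Rn n → ℂ) → ℝ≥0∞ :=
  fun f => ⨆ (g : Rn n → ℂ) (_ : AEMeasurable g volume) (_ : ρ g = 1), ∫⁻ x, ‖f x * g x‖ₑ

open Classical in
/-- The norm `‖g‖_X` of a function with values in `[0, ∞]`; it is infinite unless `g` is finite
almost everywhere. -/
def extNorm {n : ℕ} (ρ : (Rn n → ℂ) → ℝ≥0∞) (g : Rn n → ℝ≥0∞) : ℝ≥0∞ :=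
  if ∀ᵐ x ∂volume, g x < ∞ then ρ (fun x => ((g x).toReal : ℂ)) else ∞

/-- The (uncentered) Hardy–Littlewood maximal function. -/
def maximal {n : ℕ} (f : Rn n → ℂ) (x : Rn n) : ℝ≥0∞ :=
  ⨆ (c : Rn n) (r : ℝ) (_ : 0 < r) (_ : x ∈ Metric.ball c r),
    (volume (Metric.ball c r))⁻¹ * ∫⁻ y in Metric.ball c r, ‖f y‖ₑ

/-- The operator norm `‖𝓜‖_{X → X}` of the Hardy–Littlewood maximal operator; `𝓜` is bounded
on `X` if and only if it is finite. -/
def maximalOpNorm {n : ℕ} (ρ : (Rn n → ℂ) → ℝ≥0∞) : ℝ≥0∞ :=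
  ⨆ (f : Rn n → ℂ) (_ : AEMeasurable f volume) (_ : ρ f ≤ 1), extNorm ρ (maximal f)

/-- The pointwise Euclidean length `|∇f|` of the gradient `(∂₁f, …, ∂ₙf)`. -/
def gradNorm {n : ℕ} (f : Rn n → ℂ) (x : Rn n) : ℝ :=
  √(∑ i : Fin n, ‖fderiv ℝ f x (EuclideanSpace.single i 1)‖ ^ 2)

/-- The set `E_{l, s}[f]` of the pairs `x ≠ y` with `|f(x) - f(y)| / |x - y|^{1 + s} > l`. -/
def diffSet {n : ℕ} (f : Rn n → ℂ) (l s : ℝ) : Set (Rn n × Rn n) :=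
  {z | z.1 ≠ z.2 ∧ l < ‖f z.1 - f z.2‖ / ‖z.1 - z.2‖ ^ (1 + s)}

/-- The function `x ↦ [∫ 1_{E_{l, γ/q}[f]}(x, y) |x - y|^{γ - n} dy]^{1/q}`. -/
def levelFunction {n : ℕ} (f : Rn n → ℂ) (l γ q : ℝ) (x : Rn n) : ℝ≥0∞ :=
  (∫⁻ y, (diffSet f l (γ / q)).indicator
    (fun z => ENNReal.ofReal (‖z.1 - z.2‖ ^ (γ - n))) (x, y)) ^ (1 / q)

end BallSpace

end

namespace BallSpace

variable {n : ℕ} {ρ : (Rn n → ℂ) → ℝ≥0∞}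

/-! Write `M` for the maximal function of `|∇f|` and `Y` for `X^{1/p}`. The heart is the case `q =
p`. The Lusin–Lipschitz inequality `enorm_sub_le_maximal` bounds `|f(x) - f(y)|` by `2^n |x - y|
(M(x) + M(y))`, so a pair in the level set satisfies `|x - y|^γ < R(x)` or `|x - y|^γ < R(y)`, where
`R = (2^{n+1} M / λ)^p` (`lt_radius_of_mem_diffSet`).

The near part, governed by `R(x)`, integrates `|x - y|^{γ-n}` to at most a multiple of `R(x)`. The
far part, governed by `R(y)`, has no such pointwise bound and is treated by duality. Tested against
`g`, Tonelli makes `y` the centre, and a dyadic decomposition (`lintegral_kernel_le`) bounds the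
pairing by a multiple of `∫ R · 𝓜g`. Hölder's inequality and the boundedness of `𝓜` on `Y'` then
give the norm of `R` in `Y`, which is the `p`-th power of the norm of `2^{n+1} M / λ` in `X`. The
boundedness of `𝓜` on `X` finishes, and `λ` cancels after taking a `p`-th root.

Recovering the norm of `Y` from its associate is the Lorentz–Luxemburg theorem,
`extNorm_le_of_associate`, proved by Hahn–Banach separation in `L²` followed by truncation.

For `q < p`, replace `γ` by `pγ/q`: the level set is unchanged, and `lintegral_kernel_le_rpow`
compares the two weighted measures of its sections. -/

theorem enorm_ofReal (t : ℝ) : ‖(t : ℂ)‖ₑ = ‖t‖ₑ := by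
  simp [enorm_eq_nnnorm]

/-! ### Norms of `[0, ∞]`-valued functions and Hölder's inequality -/

theorem IsBallQuasiBanach.congr_ae (hρ : IsBallQuasiBanach ρ) {f g : Rn n → ℂ}
    (hf : AEMeasurable f volume) (hg : AEMeasurable g volume) (h : f =ᵐ[volume] g) :
    ρ f = ρ g :=
  le_antisymm (hρ.mono g f hg hf (h.mono fun x hx => by rw [hx]))
    (hρ.mono f g hf hg (h.mono fun x hx => by rw [hx]))

theorem IsBallQuasiBanach.zero (hρ : IsBallQuasiBanach ρ) : ρ (fun _ => 0) = 0 := by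
  simpa using hρ.smul 0 (fun _ => 0) aemeasurable_const

theorem aemeasurable_toReal_ofReal {F : Rn n → ℝ≥0∞} (hF : AEMeasurable F volume) :
    AEMeasurable (fun x => ((F x).toReal : ℂ)) volume :=
  Complex.measurable_ofReal.comp_aemeasurable hF.ennreal_toReal

theorem extNorm_of_finite {F : Rn n → ℝ≥0∞} (h : ∀ᵐ x ∂volume, F x < ∞) :
    extNorm ρ F = ρ (fun x => ((F x).toReal : ℂ)) := if_pos h

theorem ae_lt_top_of_extNorm {F : Rn n → ℝ≥0∞} (h : extNorm ρ F < ∞) :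
    ∀ᵐ x ∂volume, F x < ∞ := by
  by_contra h'
  rw [extNorm, if_neg h'] at h
  exact lt_irrefl _ h

theorem IsBallQuasiBanach.extNorm_mono (hρ : IsBallQuasiBanach ρ) {F G : Rn n → ℝ≥0∞}
    (hF : AEMeasurable F volume) (hG : AEMeasurable G volume) (h : ∀ᵐ x ∂volume, F x ≤ G x) :
    extNorm ρ F ≤ extNorm ρ G := by
  by_cases hfin : ∀ᵐ x ∂volume, G x < ∞
  · have hfin' : ∀ᵐ x ∂volume, F x < ∞ := by
      filter_upwards [h, hfin] with x hx hx' using hx.trans_lt hx'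
    rw [extNorm_of_finite hfin, extNorm_of_finite hfin']
    refine hρ.mono _ _ (aemeasurable_toReal_ofReal hG) (aemeasurable_toReal_ofReal hF) ?_
    filter_upwards [h, hfin] with x hx hx'
    simp only [Complex.norm_real, Real.norm_eq_abs, ENNReal.abs_toReal]
    exact ENNReal.toReal_mono hx'.ne hx
  · rw [extNorm.eq_1 ρ G, if_neg hfin]
    exact le_top

theorem IsBallQuasiBanach.extNorm_const_mul (hρ : IsBallQuasiBanach ρ) (c : ℝ≥0)
    {F : Rn n → ℝ≥0∞} (hF : AEMeasurable F volume) :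
    extNorm ρ (fun x => c * F x) ≤ c * extNorm ρ F := by
  rcases eq_or_ne c 0 with rfl | hc
  · rw [extNorm_of_finite (by simp)]
    simp [hρ.zero]
  by_cases hfin : ∀ᵐ x ∂volume, F x < ∞
  · rw [extNorm_of_finite hfin, extNorm_of_finite
      (hfin.mono fun x hx => ENNReal.mul_lt_top ENNReal.coe_lt_top hx)]
    have := hρ.smul (c : ℝ) _ (aemeasurable_toReal_ofReal hF)
    simp only [ENNReal.toReal_mul, ENNReal.coe_toReal, Complex.ofReal_mul]
    rw [this]
    gcongr
    simp [enorm_eq_nnnorm]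
  · rw [extNorm.eq_1 ρ F, if_neg hfin, ENNReal.mul_top (by simpa using hc)]
    exact le_top

theorem IsBallBanach.extNorm_add (hρ : IsBallBanach ρ) {F G : Rn n → ℝ≥0∞}
    (hF : AEMeasurable F volume) (hG : AEMeasurable G volume) :
    extNorm ρ (fun x => F x + G x) ≤ extNorm ρ F + extNorm ρ G := by
  by_cases h1 : extNorm ρ F < ∞
  swap
  · simp [not_lt_top_iff.1 h1]
  by_cases h2 : extNorm ρ G < ∞
  swap
  · simp [not_lt_top_iff.1 h2]
  have f1 := ae_lt_top_of_extNorm h1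
  have f2 := ae_lt_top_of_extNorm h2
  have f3 : ∀ᵐ x ∂volume, F x + G x < ∞ := by
    filter_upwards [f1, f2] with x a b using ENNReal.add_lt_top.2 ⟨a, b⟩
  rw [extNorm_of_finite f1] at h1 ⊢
  rw [extNorm_of_finite f2] at h2 ⊢
  rw [extNorm_of_finite f3]
  have m1 := aemeasurable_toReal_ofReal hF
  have m2 := aemeasurable_toReal_ofReal hG
  refine le_trans (le_of_eq ?_) (hρ.triangle _ _ m1 m2 h1 h2)
  refine hρ.congr_ae (aemeasurable_toReal_ofReal (hF.add hG)) (m1.add m2) ?_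
  filter_upwards [f1, f2] with x a b
  simp [ENNReal.toReal_add a.ne b.ne]

theorem extNorm_convexification {p : ℝ} (hp : 0 < p) (F : Rn n → ℝ≥0∞) :
    extNorm (convexification ρ (1 / p)) F = extNorm ρ (fun x => F x ^ (1 / p)) ^ p := by
  have hp' : 0 < 1 / p := by positivity
  have key : (∀ᵐ x ∂volume, F x ^ (1 / p) < ∞) ↔ ∀ᵐ x ∂volume, F x < ∞ := by
    refine eventually_congr (Eventually.of_forall fun x => ?_)
    exact ENNReal.rpow_lt_top_iff_of_pos hp'
  by_cases hfin : ∀ᵐ x ∂volume, F x < ∞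
  · rw [extNorm_of_finite hfin, extNorm_of_finite (key.2 hfin), convexification]
    simp [ENNReal.toReal_rpow]
  · rw [extNorm, extNorm, if_neg hfin, if_neg (mt key.1 hfin), ENNReal.top_rpow_of_pos hp]

/-- Hölder's inequality: after division by its norm, `f` competes in the supremum defining the
associate norm; if the norm is zero, `f` vanishes almost everywhere. -/
theorem IsBallQuasiBanach.lintegral_mul_le (hρ : IsBallQuasiBanach ρ) {f : Rn n → ℂ}
    (hf : AEMeasurable f volume) (hfin : ρ f < ∞) (g : Rn n → ℂ) :
    ∫⁻ x, ‖f x‖ₑ * ‖g x‖ₑ ≤ ρ f * associate ρ g := by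
  by_cases h0 : ρ f = 0
  · have := hρ.eq_zero f hf h0
    rw [lintegral_congr_ae (g := fun _ => 0) (this.mono fun x hx => by simp [hx])]
    simp
  set a := (ρ f).toReal with ha
  have ha0 : 0 < a := ENNReal.toReal_pos h0 hfin.ne
  have hfa : ρ f = ENNReal.ofReal a := (ENNReal.ofReal_toReal hfin.ne).symm
  have hca : ‖((a⁻¹ : ℝ) : ℂ)‖ₑ = (ENNReal.ofReal a)⁻¹ := by
    rw [← ENNReal.ofReal_inv_of_pos ha0, enorm_ofReal, Real.enorm_eq_ofReal (by positivity)]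
  have h1 : ρ (fun x => ((a⁻¹ : ℝ) : ℂ) * f x) = 1 := by
    rw [hρ.smul _ _ hf, hca, ← hfa, ENNReal.inv_mul_cancel h0 hfin.ne]
  have h2 : ∫⁻ x, ‖g x * (((a⁻¹ : ℝ) : ℂ) * f x)‖ₑ ≤ associate ρ g :=
    le_iSup_of_le _ (le_iSup_of_le (hf.const_mul _) (le_iSup_of_le h1 le_rfl))
  have h3 : ∫⁻ x, ‖g x * (((a⁻¹ : ℝ) : ℂ) * f x)‖ₑ = (ρ f)⁻¹ * ∫⁻ x, ‖f x‖ₑ * ‖g x‖ₑ := by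
    rw [← lintegral_const_mul' _ _ (ENNReal.inv_ne_top.2 h0)]
    refine lintegral_congr fun x => ?_
    rw [enorm_mul, enorm_mul, hca, hfa]
    ring
  rw [h3] at h2
  calc _ = ρ f * ((ρ f)⁻¹ * ∫⁻ x, ‖f x‖ₑ * ‖g x‖ₑ) := by
        rw [← mul_assoc, ENNReal.mul_inv_cancel h0 hfin.ne, one_mul]
    _ ≤ _ := by gcongr

theorem IsBallQuasiBanach.lintegral_mul_le_extNorm (hρ : IsBallQuasiBanach ρ)
    {F G : Rn n → ℝ≥0∞} (hF : AEMeasurable F volume) (hfin : extNorm ρ F < ∞)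
    (hG : ∀ᵐ x ∂volume, G x < ∞) :
    ∫⁻ x, F x * G x ≤ extNorm ρ F * extNorm (associate ρ) G := by
  have h1 := ae_lt_top_of_extNorm hfin
  rw [extNorm_of_finite h1] at hfin ⊢
  rw [extNorm_of_finite hG]
  refine le_trans (le_of_eq (lintegral_congr_ae ?_))
    (hρ.lintegral_mul_le (aemeasurable_toReal_ofReal hF) hfin _)
  filter_upwards [h1, hG] with x a b
  rw [enorm_ofReal, enorm_ofReal, Real.enorm_eq_ofReal ENNReal.toReal_nonneg,
    Real.enorm_eq_ofReal ENNReal.toReal_nonneg, ENNReal.ofReal_toReal a.ne,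
    ENNReal.ofReal_toReal b.ne]

/-! ### Lorentz–Luxemburg duality -/

/-- The Fatou axiom concerns increasing sequences only, so it is applied to the tail infima of `|u
k|`, which increase to `|v|` and are dominated by `|u k|`. -/
theorem IsBallQuasiBanach.le_of_tendsto_ae (hρ : IsBallQuasiBanach ρ) {u : ℕ → Rn n → ℝ}
    {v : Rn n → ℝ} (hu : ∀ k, AEMeasurable (u k) volume) (hv : AEMeasurable v volume)
    (h : ∀ᵐ x ∂volume, Tendsto (fun k => u k x) atTop (𝓝 (v x))) {A : ℝ≥0∞}
    (hA : ∀ k, ρ (fun x => (u k x : ℂ)) ≤ A) : ρ (fun x => (v x : ℂ)) ≤ A := by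
  have bdd : ∀ k x, BddBelow (Set.range fun m => |u (k + m) x|) := fun k x =>
    ⟨0, by rintro _ ⟨m, rfl⟩; exact abs_nonneg _⟩
  have hw : ∀ k, AEMeasurable (fun x => ⨅ m, |u (k + m) x|) volume := fun k =>
    AEMeasurable.iInf fun m => (hu (k + m)).norm
  have hF := hρ.fatou (fun k x => ⨅ m, |u (k + m) x|) (fun x => |v x|) hw hv.norm ?_
  · have e : ρ (fun x => (v x : ℂ)) = ρ (fun x => ((|v x| : ℝ) : ℂ)) := by
      refine le_antisymm (hρ.mono _ _ ?_ ?_ ?_) (hρ.mono _ _ ?_ ?_ ?_) <;> first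
        | exact Complex.measurable_ofReal.comp_aemeasurable hv
        | exact Complex.measurable_ofReal.comp_aemeasurable hv.norm
        | simp
    rw [e]
    refine le_of_tendsto' hF.2 fun k => le_trans (hρ.mono _ _ ?_ ?_ ?_) (hA k)
    · exact Complex.measurable_ofReal.comp_aemeasurable (hu k)
    · exact Complex.measurable_ofReal.comp_aemeasurable (hw k)
    · refine Eventually.of_forall fun x => ?_
      simp only [Complex.norm_real, Real.norm_eq_abs]
      rw [abs_of_nonneg (Real.iInf_nonneg fun m => abs_nonneg _)]
      exact ciInf_le (bdd k x) 0
  · filter_upwards [h] with x hx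
    refine ⟨fun k => Real.iInf_nonneg fun m => abs_nonneg _, fun k l hkl => ?_, ?_⟩
    · refine le_ciInf fun m => ?_
      have := ciInf_le (bdd k x) (l - k + m)
      rwa [← add_assoc, Nat.add_sub_cancel' hkl] at this
    · have hx' := hx.abs
      rw [Metric.tendsto_atTop] at hx' ⊢
      intro ε hε
      obtain ⟨N, hN⟩ := hx' (ε / 2) (by positivity)
      refine ⟨N, fun k hk => ?_⟩
      have h1 : |v x| - ε / 2 ≤ ⨅ m, |u (k + m) x| := le_ciInf fun m => by
        have := hN (k + m) (by omega)
        rw [Real.dist_eq, abs_lt] at this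
        linarith
      have h2 := ciInf_le (bdd k x) 0
      have h3 := hN k hk
      rw [Real.dist_eq, abs_lt] at h3 ⊢
      simp only [add_zero] at h2
      constructor <;> linarith

theorem aemeasurable_ofReal {u : Rn n → ℝ} (hu : AEMeasurable u volume) :
    AEMeasurable (fun x => (u x : ℂ)) volume :=
  Complex.measurable_ofReal.comp_aemeasurable hu

theorem IsBallBanach.convex_sublevel (hρ : IsBallBanach ρ) (A : ℝ≥0) :
    Convex ℝ {h : Lp ℝ 2 (volume : Measure (Rn n)) | ρ (fun x => (h x : ℂ)) ≤ A} := by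
  intro f hf g hg a b ha hb hab
  simp only [Set.mem_ofPred_eq] at hf hg ⊢
  have mf := aemeasurable_ofReal (Lp.stronglyMeasurable f).measurable.aemeasurable
  have mg := aemeasurable_ofReal (Lp.stronglyMeasurable g).measurable.aemeasurable
  have ms := aemeasurable_ofReal (Lp.stronglyMeasurable (a • f + b • g)).measurable.aemeasurable
  have e : ρ (fun x => ((a • f + b • g : Lp ℝ 2 (volume : Measure (Rn n))) x : ℂ)) =
      ρ (fun x => (a : ℂ) * f x + (b : ℂ) * g x) := by
    refine hρ.congr_ae ms ((mf.const_mul _).add (mg.const_mul _)) ?_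
    filter_upwards [Lp.coeFn_add (a • f) (b • g), Lp.coeFn_smul a f, Lp.coeFn_smul b g]
      with x h1 h2 h3
    rw [h1, Pi.add_apply, h2, h3]
    simp
  have ea : ‖(a : ℂ)‖ₑ = ENNReal.ofReal a := by rw [enorm_ofReal, Real.enorm_eq_ofReal ha]
  have eb : ‖(b : ℂ)‖ₑ = ENNReal.ofReal b := by rw [enorm_ofReal, Real.enorm_eq_ofReal hb]
  have fa : ρ (fun x => (a : ℂ) * f x) ≤ ENNReal.ofReal a * A := by
    rw [hρ.smul _ _ mf, ea]; gcongr
  have fb : ρ (fun x => (b : ℂ) * g x) ≤ ENNReal.ofReal b * A := by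
    rw [hρ.smul _ _ mg, eb]; gcongr
  have lt : ∀ t : ℝ, ENNReal.ofReal t * A < ∞ := fun t =>
    ENNReal.mul_lt_top ENNReal.ofReal_lt_top ENNReal.coe_lt_top
  rw [e]
  refine (hρ.triangle _ _ (mf.const_mul _) (mg.const_mul _) (fa.trans_lt (lt a))
    (fb.trans_lt (lt b))).trans ((add_le_add fa fb).trans (le_of_eq ?_))
  rw [← add_mul, ← ENNReal.ofReal_add ha hb, hab, ENNReal.ofReal_one, one_mul]

/-- An `L²`-convergent sequence has an almost everywhere convergent subsequence, to which the Fatou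
property applies. -/
theorem IsBallQuasiBanach.isClosed_sublevel (hρ : IsBallQuasiBanach ρ) (A : ℝ≥0) :
    IsClosed {h : Lp ℝ 2 (volume : Measure (Rn n)) | ρ (fun x => (h x : ℂ)) ≤ A} := by
  refine IsSeqClosed.isClosed fun u v hu huv => ?_
  obtain ⟨ns, -, hns⟩ := (tendstoInMeasure_of_tendsto_Lp huv).exists_seq_tendsto_ae
  exact hρ.le_of_tendsto_ae (fun k => (Lp.stronglyMeasurable (u (ns k))).measurable.aemeasurable)
    (Lp.stronglyMeasurable v).measurable.aemeasurable hns fun k => hu (ns k)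

/-- Truncation of `u` to the ball of radius `m` at height `m`. -/
noncomputable def truncate (u : Rn n → ℝ) (m : ℕ) : Rn n → ℝ :=
  (Metric.ball (0 : Rn n) m).indicator fun x => min (u x) m

theorem truncate_measurable {u : Rn n → ℝ} (hu : AEMeasurable u volume) (m : ℕ) :
    AEMeasurable (truncate u m) volume :=
  (hu.min aemeasurable_const).indicator measurableSet_ball

theorem truncate_nonneg {u : Rn n → ℝ} (hu : ∀ x, 0 ≤ u x) (m : ℕ) (x : Rn n) :
    0 ≤ truncate u m x :=
  Set.indicator_nonneg (fun x _ => le_min (hu x) (Nat.cast_nonneg m)) x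

theorem truncate_le {u : Rn n → ℝ} (hu : ∀ x, 0 ≤ u x) (m : ℕ) (x : Rn n) :
    truncate u m x ≤ u x :=
  Set.indicator_le' (fun _ _ => min_le_left _ _) (fun x _ => hu x) x

theorem truncate_mono {u : Rn n → ℝ} (hu : ∀ x, 0 ≤ u x) (x : Rn n) :
    Monotone fun m => truncate u m x := by
  intro k l hkl
  have hkl' : (k : ℝ) ≤ l := by exact_mod_cast hkl
  simp only [truncate]
  by_cases hx : x ∈ Metric.ball (0 : Rn n) k
  · rw [Set.indicator_of_mem hx, Set.indicator_of_mem (Metric.ball_subset_ball hkl' hx)]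
    exact min_le_min_left _ hkl'
  · rw [Set.indicator_of_notMem hx]
    exact truncate_nonneg hu l x

theorem truncate_eventually_eq (u : Rn n → ℝ) (x : Rn n) :
    ∀ᶠ m in atTop, truncate u m x = u x := by
  obtain ⟨N, hN⟩ := exists_nat_gt (max ‖x‖ (u x))
  filter_upwards [eventually_ge_atTop N] with m hm
  have hm' : (N : ℝ) ≤ m := by exact_mod_cast hm
  have h1 := (le_max_left ‖x‖ (u x)).trans_lt hN
  have h2 := (le_max_right ‖x‖ (u x)).trans_lt hN
  rw [truncate, Set.indicator_of_mem (by simpa using h1.trans_le hm')]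
  exact min_eq_left (by linarith)

theorem truncate_memLp {u : Rn n → ℝ} (hu : AEMeasurable u volume) (h0 : ∀ x, 0 ≤ u x) (m : ℕ) :
    MemLp (truncate u m) 2 volume := by
  have h : MemLp ((Metric.ball (0 : Rn n) m).indicator fun _ => (m : ℝ)) 2 volume :=
    memLp_indicator_const _ measurableSet_ball _ (Or.inr measure_ball_lt_top.ne)
  refine h.mono (truncate_measurable hu m).aestronglyMeasurable (Eventually.of_forall fun x => ?_)
  rw [Real.norm_of_nonneg (truncate_nonneg h0 m x)]
  refine le_trans ?_ (le_abs_self _)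
  exact Set.indicator_le_indicator (min_le_right _ _)

theorem lintegral_le_of_forall_truncate {v u : Rn n → ℝ} (hv : AEMeasurable v volume)
    (hu : AEMeasurable u volume) (h0 : ∀ x, 0 ≤ u x) {A : ℝ≥0∞}
    (h : ∀ m, ∫⁻ x, ‖v x‖ₑ * ‖truncate u m x‖ₑ ≤ A) : ∫⁻ x, ‖v x‖ₑ * ‖u x‖ₑ ≤ A := by
  have := lintegral_tendsto_of_tendsto_of_monotone (μ := (volume : Measure (Rn n)))
    (f := fun m x => ‖v x‖ₑ * ‖truncate u m x‖ₑ) (F := fun x => ‖v x‖ₑ * ‖u x‖ₑ)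
    (fun m => hv.enorm.mul (truncate_measurable hu m).enorm)
    (Eventually.of_forall fun x k l hkl => ?_) (Eventually.of_forall fun x => ?_)
  · exact le_of_tendsto' this h
  · dsimp only
    rw [Real.enorm_eq_ofReal (truncate_nonneg h0 k x), Real.enorm_eq_ofReal (truncate_nonneg h0 l x)]
    gcongr
    exact truncate_mono h0 x hkl
  · refine tendsto_const_nhds.congr' ?_
    filter_upwards [truncate_eventually_eq u x] with m hm
    rw [hm]

/-- The sublevel set is convex and closed in `L²`, so Hahn–Banach separates `u` from it; the Riesz
theorem represents the functional by a function `w`. -/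
theorem IsBallBanach.exists_separating (hρ : IsBallBanach ρ) {u : Rn n → ℝ}
    (hu : MemLp u 2 volume) {A : ℝ≥0} (hA : ¬ ρ (fun x => (u x : ℂ)) ≤ A) :
    ∃ (w : Rn n → ℝ) (b : ℝ), Measurable w ∧ MemLp w 2 volume ∧
      (∀ g : Rn n → ℝ, MemLp g 2 volume → ρ (fun x => (g x : ℂ)) ≤ A → ∫ x, w x * g x < b) ∧
      b < ∫ x, w x * u x := by
  have hcongr : ∀ (g : Rn n → ℝ) (hg : MemLp g 2 (volume : Measure (Rn n))),
      ρ (fun x => (hg.toLp g x : ℂ)) = ρ (fun x => (g x : ℂ)) := by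
    intro g hg
    refine hρ.congr_ae (aemeasurable_ofReal (Lp.stronglyMeasurable _).measurable.aemeasurable)
      (aemeasurable_ofReal hg.aestronglyMeasurable.aemeasurable) ?_
    filter_upwards [hg.coeFn_toLp] with x hx
    rw [hx]
  have hmem : hu.toLp u ∉ {h : Lp ℝ 2 (volume : Measure (Rn n)) | ρ (fun x => (h x : ℂ)) ≤ A} :=
    fun hin => hA ((hcongr u hu).ge.trans hin)
  obtain ⟨φ, b, hb, hub⟩ := geometric_hahn_banach_closed_point (hρ.convex_sublevel A)
    (hρ.isClosed_sublevel A) hmem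
  obtain ⟨w, rfl⟩ := (InnerProductSpace.toDual ℝ (Lp ℝ 2 (volume : Measure (Rn n)))).surjective φ
  have hφ : ∀ g (hg : MemLp g 2 (volume : Measure (Rn n))),
      InnerProductSpace.toDual ℝ _ w (hg.toLp g) = ∫ x, w x * g x := by
    intro g hg
    rw [InnerProductSpace.toDual_apply_apply, L2.inner_def]
    refine integral_congr_ae ?_
    filter_upwards [hg.coeFn_toLp] with x hx
    rw [hx, mul_comm]
    rfl
  refine ⟨w, b, (Lp.stronglyMeasurable w).measurable, Lp.memLp w, fun g hg hgA => ?_, ?_⟩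
  · rw [← hφ g hg]
    exact hb _ ((hcongr g hg).le.trans hgA)
  · rwa [← hφ u hu]

theorem IsBallQuasiBanach.lintegral_abs_mul_le (hρ : IsBallQuasiBanach ρ) {A : ℝ≥0}
    {w : Rn n → ℝ} {b : ℝ} (mw : Measurable w) (hw : MemLp w 2 volume)
    (hb : ∀ g : Rn n → ℝ, MemLp g 2 volume → ρ (fun x => (g x : ℂ)) ≤ A → ∫ x, w x * g x < b)
    {g : Rn n → ℝ} (hg : MemLp g 2 volume) (hgA : ρ (fun x => (g x : ℂ)) ≤ A) :
    ∫⁻ x, ‖w x‖ₑ * ‖g x‖ₑ ≤ ENNReal.ofReal b := by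
  -- The sublevel set depends only on `|g|`, so the sign of `g` may be matched to that of `w`; this
  -- turns the signed pairing into an absolute one.
  set g' : Rn n → ℝ := fun x => if 0 ≤ w x then |g x| else -|g x| with hg'
  have mg' : AEMeasurable g' volume := by
    have h1 : AEMeasurable (fun x => |g x|) volume := hg.1.aemeasurable.norm
    have hs : MeasurableSet {x | 0 ≤ w x} := measurableSet_le measurable_const mw
    have : g' = {x | 0 ≤ w x}.indicator (fun x => |g x|) +
        {x | 0 ≤ w x}ᶜ.indicator (fun x => -|g x|) := by
      ext x
      by_cases hx : 0 ≤ w x <;> simp [hg', hx]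
    rw [this]
    exact (h1.indicator hs).add (h1.neg.indicator hs.compl)
  have habs : ∀ x, |g' x| = |g x| := fun x => by
    by_cases hx : 0 ≤ w x <;> simp [hg', hx]
  have hmul : ∀ x, w x * g' x = |w x| * |g x| := fun x => by
    by_cases hx : 0 ≤ w x
    · simp [hg', hx, abs_of_nonneg hx]
    · simp [hg', hx, abs_of_neg (not_le.1 hx)]
  have hgL : MemLp g' 2 volume :=
    hg.mono mg'.aestronglyMeasurable (Eventually.of_forall fun x => by simp [habs])
  have hlt := hb g' hgL (le_trans (hρ.mono _ _ (aemeasurable_ofReal hg.1.aemeasurable)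
    (aemeasurable_ofReal mg') (Eventually.of_forall fun x => by simp [habs])) hgA)
  rw [integral_congr_ae (Eventually.of_forall hmul)] at hlt
  have hint : Integrable (fun x => |w x| * |g x|) volume :=
    MemLp.integrable_mul (p := 2) (q := 2) hw.norm hg.norm
  have := ofReal_integral_eq_lintegral_ofReal hint (Eventually.of_forall fun x => by positivity)
  calc ∫⁻ x, ‖w x‖ₑ * ‖g x‖ₑ = ∫⁻ x, ENNReal.ofReal (|w x| * |g x|) := by
        refine lintegral_congr fun x => ?_
        rw [ENNReal.ofReal_mul (abs_nonneg _), ← Real.enorm_eq_ofReal_abs,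
          ← Real.enorm_eq_ofReal_abs]
    _ ≤ _ := by
        rw [← this]
        exact ENNReal.ofReal_le_ofReal hlt.le

/-- Bipolar argument: were the norm of `u` larger than `A`, the separating function, rescaled by `A
/ b`, would be an admissible test function pairing with `u` to more than `A`. -/
theorem IsBallBanach.norm_le_of_associate_memLp (hρ : IsBallBanach ρ) {u : Rn n → ℝ}
    (hu : MemLp u 2 volume) {A : ℝ≥0} (hA : 0 < A)
    (h : ∀ g : Rn n → ℝ, Measurable g → associate ρ (fun x => (g x : ℂ)) ≤ 1 →
      ∫⁻ x, ‖u x‖ₑ * ‖g x‖ₑ ≤ A) : ρ (fun x => (u x : ℂ)) ≤ A := by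
  by_contra hcon
  obtain ⟨w, b, mw, hw, hb, hub⟩ := hρ.exists_separating hu hcon
  have key := fun g : Rn n → ℝ => hρ.lintegral_abs_mul_le (g := g) mw hw hb
  have hb0 : 0 < b := by
    simpa using hb 0 MemLp.zero (by simp [hρ.zero])
  have hA' : (0 : ℝ) < A := hA
  have h1 : associate ρ (fun x => ((A / b * w x : ℝ) : ℂ)) ≤ 1 := by
    refine iSup_le fun g => iSup_le fun hg => iSup_le fun hg1 => ?_
    have mg : AEMeasurable (fun x => (A : ℝ) * ‖g x‖) volume := hg.norm.const_mul _
    have g0 : ∀ x, 0 ≤ (A : ℝ) * ‖g x‖ := fun x => by positivity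
    have hgA : ρ (fun x => ((A : ℝ) : ℂ) * g x) ≤ A := by
      rw [hρ.smul _ _ hg, hg1, enorm_ofReal, Real.enorm_eq_ofReal hA'.le]
      simp
    -- Separation bounds pairings with `L²` functions only; truncation extends this to `A |g|`, with
    -- `g` of norm one but possibly outside `L²`.
    have := lintegral_le_of_forall_truncate (A := ENNReal.ofReal b) mw.aemeasurable mg g0
      fun m => key _ (truncate_memLp mg g0 m) (le_trans (hρ.mono _ _ (hg.const_mul _)
        (aemeasurable_ofReal (truncate_measurable mg m)) (Eventually.of_forall fun x => by
          rw [Complex.norm_real, Real.norm_of_nonneg (truncate_nonneg g0 m x)]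
          refine (truncate_le g0 m x).trans (le_of_eq ?_)
          simp)) hgA)
    calc ∫⁻ x, ‖((A / b * w x : ℝ) : ℂ) * g x‖ₑ
        = ∫⁻ x, (ENNReal.ofReal b)⁻¹ * (‖w x‖ₑ * ‖(A : ℝ) * ‖g x‖‖ₑ) := by
          refine lintegral_congr fun x => ?_
          rw [enorm_mul, enorm_ofReal, enorm_mul, enorm_mul, enorm_norm,
            Real.enorm_eq_ofReal (div_nonneg hA'.le hb0.le), ENNReal.ofReal_div_of_pos hb0,
            Real.enorm_eq_ofReal hA'.le, ENNReal.div_eq_inv_mul]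
          ring
      _ ≤ (ENNReal.ofReal b)⁻¹ * ENNReal.ofReal b := by
          rw [lintegral_const_mul' _ _ (ENNReal.inv_ne_top.2 (by simpa using hb0))]
          gcongr
      _ ≤ 1 := ENNReal.inv_mul_le_one _
  have h2 := h _ (mw.const_mul (A / b : ℝ)) h1
  have h3 : ENNReal.ofReal b < ∫⁻ x, ‖w x‖ₑ * ‖u x‖ₑ := by
    have : ENNReal.ofReal (∫ x, w x * u x) ≤ ∫⁻ x, ‖w x‖ₑ * ‖u x‖ₑ := by
      refine le_trans (ENNReal.ofReal_le_ofReal (le_abs_self _)) ?_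
      rw [← Real.enorm_eq_ofReal_abs]
      refine (enorm_integral_le_lintegral_enorm _).trans (le_of_eq ?_)
      simp only [enorm_mul]
    exact lt_of_lt_of_le ((ENNReal.ofReal_lt_ofReal_iff_of_nonneg hb0.le).2 hub) this
  have h4 : ∫⁻ x, ‖u x‖ₑ * ‖(A / b : ℝ) * w x‖ₑ =
      ENNReal.ofReal (A / b) * ∫⁻ x, ‖w x‖ₑ * ‖u x‖ₑ := by
    rw [← lintegral_const_mul' _ _ ENNReal.ofReal_ne_top]
    refine lintegral_congr fun x => ?_
    rw [enorm_mul, Real.enorm_eq_ofReal (div_nonneg hA'.le hb0.le)]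
    ring
  rw [h4] at h2
  have h5 : ENNReal.ofReal (A / b) * ENNReal.ofReal b = A := by
    rw [← ENNReal.ofReal_mul (div_nonneg hA'.le hb0.le), div_mul_cancel₀ _ hb0.ne']
    simp
  have h6 := (ENNReal.mul_lt_mul_iff_right (a := ENNReal.ofReal (A / b))
    (by simp; positivity) ENNReal.ofReal_ne_top).2 h3
  rw [h5] at h6
  exact absurd h2 (not_le.2 h6)

theorem IsBallBanach.extNorm_le_of_associate (hρ : IsBallBanach ρ) {F : Rn n → ℝ≥0∞}
    (hF : AEMeasurable F volume) {A : ℝ≥0∞}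
    (h : ∀ g : Rn n → ℝ, Measurable g → associate ρ (fun x => (g x : ℂ)) ≤ 1 →
      ∫⁻ x, F x * ‖g x‖ₑ ≤ A) : extNorm ρ F ≤ A := by
  -- The separation argument needs a positive level, and `A` may vanish; hence the slack `ε`.
  refine ENNReal.le_of_forall_pos_le_add fun ε hε hA => ?_
  lift A to ℝ≥0 using hA.ne
  -- By the local integrability axiom, `C⁻¹ 1_B` has associate norm at most one, so it is an
  -- admissible test function and forces `F` to be integrable on each ball.
  have hfin : ∀ᵐ x ∂volume, F x < ∞ := by
    have hball : ∀ N : ℕ, ∀ᵐ x ∂volume, x ∈ Metric.ball (0 : Rn n) (N + 1) → F x < ∞ := by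
      intro N
      obtain ⟨C, hC, hC'⟩ := hρ.integral_ball_le 0 (N + 1) (by positivity)
      have hCr : (0 : ℝ) < C := hC
      have e : ∀ x, ‖(Metric.ball (0 : Rn n) (N + 1)).indicator (fun _ => (C : ℝ)⁻¹) x‖ₑ =
          (Metric.ball (0 : Rn n) (N + 1)).indicator (fun _ => (C : ℝ≥0∞)⁻¹) x := by
        intro x
        by_cases hx : x ∈ Metric.ball (0 : Rn n) (N + 1)
        · rw [Set.indicator_of_mem hx, Set.indicator_of_mem hx,
            Real.enorm_eq_ofReal (by positivity), ENNReal.ofReal_inv_of_pos hCr]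
          simp
        · simp [hx]
      have h1 := h ((Metric.ball (0 : Rn n) (N + 1)).indicator fun _ => (C : ℝ)⁻¹)
        (measurable_const.indicator measurableSet_ball) (by
          refine iSup_le fun g => iSup_le fun hg => iSup_le fun hg1 => ?_
          have := hC' g hg (by simp [hg1])
          rw [hg1, mul_one] at this
          calc _ = ∫⁻ x in Metric.ball (0 : Rn n) (N + 1), (C : ℝ≥0∞)⁻¹ * ‖g x‖ₑ := by
                rw [← lintegral_indicator measurableSet_ball]
                refine lintegral_congr fun x => ?_
                rw [enorm_mul, enorm_ofReal, e]
                by_cases hx : x ∈ Metric.ball (0 : Rn n) (N + 1) <;> simp [hx]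
            _ ≤ (C : ℝ≥0∞)⁻¹ * C := by
                rw [lintegral_const_mul' _ _ (ENNReal.inv_ne_top.2 (by simpa using hC.ne'))]
                gcongr
            _ ≤ 1 := ENNReal.inv_mul_le_one _)
      simp only [e] at h1
      have h2 := ae_lt_top' (hF.mul ((measurable_const (a := (C : ℝ≥0∞)⁻¹)).indicator
        (measurableSet_ball (x := (0 : Rn n)) (ε := (N + 1 : ℝ)))).aemeasurable)
        (h1.trans_lt ENNReal.coe_lt_top).ne
      filter_upwards [h2] with x hx hxb
      by_contra hcon
      simp only [Pi.mul_apply, Set.indicator_of_mem hxb, not_lt_top_iff.1 hcon] at hx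
      rw [ENNReal.top_mul (by simp)] at hx
      exact lt_irrefl _ hx
    filter_upwards [ae_all_iff.2 hball] with x hx
    obtain ⟨N, hN⟩ := exists_nat_gt ‖x‖
    exact hx N (by simp; linarith)
  rw [extNorm_of_finite hfin]
  have mF := hF.ennreal_toReal
  have F0 : ∀ x, 0 ≤ (F x).toReal := fun x => ENNReal.toReal_nonneg
  have hlim := (hρ.fatou (truncate fun x => (F x).toReal) (fun x => (F x).toReal)
    (truncate_measurable mF) mF (Eventually.of_forall fun x =>
      ⟨fun m => truncate_nonneg F0 m x, truncate_mono F0 x,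
        tendsto_const_nhds.congr' ((truncate_eventually_eq _ x).mono fun m hm => hm.symm)⟩)).2
  refine le_of_tendsto' hlim fun m => ?_
  rw [← ENNReal.coe_add]
  refine hρ.norm_le_of_associate_memLp (truncate_memLp mF F0 m) (by positivity) fun g hg hg1 => ?_
  refine le_trans (lintegral_mono_ae ?_) ((h g hg hg1).trans (by simp))
  filter_upwards [hfin] with x hx
  gcongr
  rw [Real.enorm_eq_ofReal (truncate_nonneg F0 m x)]
  refine (ENNReal.ofReal_le_ofReal (truncate_le F0 m x)).trans ?_
  rw [ENNReal.ofReal_toReal hx.ne]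

/-! ### The maximal operator -/

theorem lowerSemicontinuous_maximal (f : Rn n → ℂ) : LowerSemicontinuous (maximal f) := by
  intro x a hax
  simp only [maximal, lt_iSup_iff] at hax
  obtain ⟨c, r, hr, hx, h⟩ := hax
  filter_upwards [Metric.isOpen_ball.mem_nhds hx] with y hy
  exact h.trans_le (le_iSup_of_le c (le_iSup_of_le r (le_iSup_of_le hr (le_iSup_of_le hy le_rfl))))

theorem measurable_maximal (f : Rn n → ℂ) : Measurable (maximal f) :=
  (lowerSemicontinuous_maximal f).measurable

theorem lintegral_ball_le_maximal (f : Rn n → ℂ) (x : Rn n) {r : ℝ} (hr : 0 < r) :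
    ∫⁻ y in Metric.ball x r, ‖f y‖ₑ ≤
      ENNReal.ofReal (r ^ n) * volume (Metric.ball (0 : Rn n) 1) * maximal f x := by
  have h : (volume (Metric.ball x r))⁻¹ * ∫⁻ y in Metric.ball x r, ‖f y‖ₑ ≤ maximal f x :=
    le_iSup_of_le x (le_iSup_of_le r (le_iSup_of_le hr
      (le_iSup_of_le (Metric.mem_ball_self hr) le_rfl)))
  have h0 : volume (Metric.ball x r) ≠ 0 := (Metric.measure_ball_pos volume x hr).ne'
  have e : volume (Metric.ball x r) =
      ENNReal.ofReal (r ^ n) * volume (Metric.ball (0 : Rn n) 1) := by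
    rw [Measure.addHaar_ball_of_pos volume x hr, finrank_euclideanSpace_fin]
  rw [← e]
  calc _ = volume (Metric.ball x r) * ((volume (Metric.ball x r))⁻¹ *
        ∫⁻ y in Metric.ball x r, ‖f y‖ₑ) := by
        rw [← mul_assoc, ENNReal.mul_inv_cancel h0 measure_ball_lt_top.ne, one_mul]
    _ ≤ _ := by gcongr

theorem maximal_le_of_bound {f : Rn n → ℂ} {B : ℝ≥0∞} (h : ∀ x, ‖f x‖ₑ ≤ B) (x : Rn n) :
    maximal f x ≤ B := by
  refine iSup_le fun c => iSup_le fun r => iSup_le fun hr => iSup_le fun _ => ?_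
  calc _ ≤ (volume (Metric.ball c r))⁻¹ * ∫⁻ _ in Metric.ball c r, B := by
        gcongr with y; exact h y
    _ = B * ((volume (Metric.ball c r))⁻¹ * volume (Metric.ball c r)) := by
        rw [setLIntegral_const]; ring
    _ ≤ B := by
        grw [ENNReal.inv_mul_le_one]; simp

theorem extNorm_maximal_le {f : Rn n → ℂ} (hf : AEMeasurable f volume) (h1 : ρ f ≤ 1) :
    extNorm ρ (maximal f) ≤ maximalOpNorm ρ :=
  le_iSup_of_le f (le_iSup_of_le hf (le_iSup_of_le h1 le_rfl))

theorem maximal_congr_ae {f g : Rn n → ℂ} (h : f =ᵐ[volume] g) : maximal f = maximal g := by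
  ext x
  simp only [maximal]
  refine iSup_congr fun c => iSup_congr fun r => iSup_congr fun hr => iSup_congr fun hx => ?_
  congr 1
  exact lintegral_congr_ae (ae_restrict_of_ae (h.mono fun y hy => by simp only [hy]))

theorem maximal_const_mul {c : ℂ} (f : Rn n → ℂ) (x : Rn n) :
    maximal (fun y => c * f y) x = ‖c‖ₑ * maximal f x := by
  simp only [maximal, ENNReal.mul_iSup]
  refine iSup_congr fun a => iSup_congr fun r => iSup_congr fun hr => iSup_congr fun hx => ?_
  simp only [enorm_mul]
  rw [lintegral_const_mul' _ _ enorm_ne_top]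
  ring

theorem IsBallQuasiBanach.extNorm_maximal_le_mul (hρ : IsBallQuasiBanach ρ) {f : Rn n → ℂ}
    (hf : AEMeasurable f volume) (hfin : ρ f < ∞) :
    extNorm ρ (maximal f) ≤ maximalOpNorm ρ * ρ f := by
  by_cases h0 : ρ f = 0
  · have : maximal f = maximal fun _ => 0 := maximal_congr_ae (hρ.eq_zero f hf h0)
    have h2 : maximal f = fun _ => 0 := by
      ext x
      rw [this]
      exact le_antisymm (maximal_le_of_bound (by simp) x) bot_le
    rw [h2, extNorm_of_finite (by simp)]
    simp [hρ.zero]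
  lift ρ f to ℝ≥0 using hfin.ne with a ha
  have ha0 : (0 : ℝ) < a := by
    have : a ≠ 0 := by simpa using h0
    positivity
  have hc : ‖((a⁻¹ : ℝ) : ℂ)‖ₑ = (a : ℝ≥0∞)⁻¹ := by
    rw [enorm_ofReal, Real.enorm_eq_ofReal (by positivity), ENNReal.ofReal_inv_of_pos ha0]
    simp
  have h1 : ρ (fun x => ((a⁻¹ : ℝ) : ℂ) * f x) ≤ 1 := by
    rw [hρ.smul _ _ hf, hc, ← ha]
    exact ENNReal.inv_mul_le_one _
  have h2 := extNorm_maximal_le (hf.const_mul _) h1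
  have h3 : maximal f = fun x => a * maximal (fun x => ((a⁻¹ : ℝ) : ℂ) * f x) x := by
    ext x
    rw [maximal_const_mul, hc, ← mul_assoc, ENNReal.mul_inv_cancel h0 ENNReal.coe_ne_top, one_mul]
  rw [h3]
  refine (hρ.extNorm_const_mul a (measurable_maximal _).aemeasurable).trans ?_
  rw [mul_comm]
  gcongr

/-! ### Truncated kernels and the maximal function -/

/-- Comparability of `t` with `u ^ (1 / γ)` when `t ^ γ` is comparable with `u`. -/
theorem bounds_of_rpow_bounds {γ t u : ℝ} (hγ : γ ≠ 0) (ht : 0 < t) (hu : 0 < u)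
    (h1 : u / 2 ≤ t ^ γ) (h2 : t ^ γ ≤ u) :
    t ≤ 2 ^ (1 / |γ|) * u ^ (1 / γ) ∧ u ^ (1 / γ) ≤ 2 ^ (1 / |γ|) * t := by
  have hγ' : 0 < |γ| := abs_pos.2 hγ
  have l1 : Real.log u - Real.log 2 ≤ γ * Real.log t := by
    rw [← Real.log_div hu.ne' (by norm_num), ← Real.log_rpow ht]
    exact Real.log_le_log (by positivity) h1
  have l2 : γ * Real.log t ≤ Real.log u := by
    rw [← Real.log_rpow ht]
    exact Real.log_le_log (by positivity) h2
  have l3 : |Real.log t - Real.log u / γ| ≤ Real.log 2 / |γ| := by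
    rw [le_div_iff₀ hγ', ← abs_mul, abs_le]
    have : (Real.log t - Real.log u / γ) * γ = γ * Real.log t - Real.log u := by field_simp
    rw [this]
    have := Real.log_pos (by norm_num : (1 : ℝ) < 2)
    constructor <;> linarith
  rw [abs_le] at l3
  have e1 : (2 : ℝ) ^ (1 / |γ|) = Real.exp (Real.log 2 / |γ|) := by
    rw [Real.rpow_def_of_pos (by norm_num)]; ring_nf
  have e2 : u ^ (1 / γ) = Real.exp (Real.log u / γ) := by
    rw [Real.rpow_def_of_pos hu]; ring_nf
  rw [e1, e2, ← Real.exp_add]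
  constructor
  · calc t = Real.exp (Real.log t) := (Real.exp_log ht).symm
      _ ≤ _ := Real.exp_le_exp.2 (by linarith)
  · calc _ ≤ Real.exp (Real.log 2 / |γ| + Real.log t) := Real.exp_le_exp.2 (by linarith)
      _ = _ := by rw [Real.exp_add, Real.exp_log ht]

/-- The constant in the estimate of truncated kernels by the maximal function. -/
noncomputable def kernelConst (n : ℕ) (γ : ℝ) : ℝ≥0 :=
  2 * (2 * 2 ^ (1 / |γ|) * 2 ^ (1 / |γ|)) ^ n * (volume (Metric.ball (0 : Rn n) 1)).toNNReal

/-- The dyadic decomposition is in the value of `t ^ γ`, not of `t`, which treats both signs of `γ`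
at once. The extra factor 2 in the radius yields the strict inequality needed for open balls. -/
theorem kernel_le_tsum {γ T t : ℝ} (hγ : γ ≠ 0) (hT : 0 < T) (ht : 0 < t) (hlt : t ^ γ < T) :
    ENNReal.ofReal (t ^ (γ - n)) ≤ ∑' k : ℕ,
      (Set.Iio (2 * 2 ^ (1 / |γ|) * (T * (1 / 2) ^ k) ^ (1 / γ))).indicator
        (fun _ => ENNReal.ofReal (T * (1 / 2) ^ k *
          (2 ^ (1 / |γ|) / (T * (1 / 2) ^ k) ^ (1 / γ)) ^ n)) t := by
  obtain ⟨k, hk1, hk2⟩ := exists_nat_pow_near_of_lt_one (x := t ^ γ / T) (y := 1 / 2)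
    (by positivity) (by rw [div_le_one hT]; exact hlt.le) (by norm_num) (by norm_num)
  rw [div_le_iff₀' hT] at hk2
  rw [lt_div_iff₀' hT] at hk1
  refine le_trans ?_ (ENNReal.le_tsum k)
  have hu : 0 < T * (1 / 2) ^ k := by positivity
  set u := T * (1 / 2) ^ k
  have hk1' : u / 2 ≤ t ^ γ := by
    refine le_trans (le_of_eq ?_) hk1.le
    simp only [u]; ring
  obtain ⟨b1, b2⟩ := bounds_of_rpow_bounds hγ ht hu hk1' hk2
  have hr : 0 < u ^ (1 / γ) := by positivity
  have hc : (0 : ℝ) < 2 ^ (1 / |γ|) := by positivity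
  rw [Set.indicator_of_mem]
  · refine ENNReal.ofReal_le_ofReal ?_
    rw [Real.rpow_sub ht, Real.rpow_natCast, div_eq_mul_inv, ← inv_pow]
    gcongr
    rw [inv_le_comm₀ ht (by positivity), inv_div, div_le_iff₀ hc]
    linarith
  · rw [Set.mem_Iio]
    nlinarith [mul_pos hc hr]

/-- On the shell where `|x - y|^γ` is about `u k = T / 2^k`, the kernel is about `u k / r k ^ n`
with `r k = u k ^ (1/γ)`, and the shell lies in a ball of radius comparable to `r k`. Each shell
thus costs a multiple of `u k` times the maximal function, a geometric series. For `γ < 0` the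
region is the exterior of a ball and the radii grow, with the same bound. -/
theorem lintegral_kernel_le (hn : 1 ≤ n) {γ T : ℝ} (hγ : γ ≠ 0) (hT : 0 ≤ T) {h : Rn n → ℂ}
    (hh : AEMeasurable h volume) (x : Rn n) :
    ∫⁻ y in {y | ‖x - y‖ ^ γ < T}, ENNReal.ofReal (‖x - y‖ ^ (γ - n)) * ‖h y‖ₑ ≤
      kernelConst n γ * ENNReal.ofReal T * maximal h x := by
  have : Nonempty (Fin n) := ⟨⟨0, hn⟩⟩
  rcases hT.eq_or_lt with rfl | hT
  · have : {y : Rn n | ‖x - y‖ ^ γ < 0} = ∅ := by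
      ext y
      simp only [Set.mem_ofPred_eq, Set.mem_empty_iff_false, iff_false, not_lt]
      positivity
    rw [this]; simp
  have hmeas : MeasurableSet {y : Rn n | ‖x - y‖ ^ γ < T} :=
    measurableSet_lt ((measurable_const.sub measurable_id).norm.pow_const γ) measurable_const
  set c : ℝ := 2 ^ (1 / |γ|) with hc
  have hc0 : 0 < c := by positivity
  set u : ℕ → ℝ := fun k => T * (1 / 2) ^ k with hu
  have hu0 : ∀ k, 0 < u k := fun k => by positivity
  set r : ℕ → ℝ := fun k => u k ^ (1 / γ) with hr
  have hr0 : ∀ k, 0 < r k := fun k => Real.rpow_pos_of_pos (hu0 k) _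
  set V := volume (Metric.ball (0 : Rn n) 1) with hV
  calc _ ≤ ∫⁻ y, ∑' k, ENNReal.ofReal (u k * (c / r k) ^ n) *
        (Metric.ball x (2 * c * r k)).indicator (fun y => ‖h y‖ₑ) y := by
        rw [← lintegral_indicator hmeas]
        refine lintegral_mono_ae ?_
        have hne : ∀ᵐ y : Rn n ∂volume, y ≠ x := by
          simp [ae_iff]
        filter_upwards [hne] with y hy
        by_cases hyT : ‖x - y‖ ^ γ < T
        · rw [Set.indicator_of_mem (by exact hyT)]
          have := kernel_le_tsum (n := n) hγ hT (norm_pos_iff.2 (sub_ne_zero.2 hy.symm)) hyT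
          refine (mul_le_mul_left this _).trans (le_of_eq ?_)
          rw [← ENNReal.tsum_mul_right]
          refine tsum_congr fun k => ?_
          by_cases hk : ‖x - y‖ < 2 * c * r k
          · rw [Set.indicator_of_mem (by exact hk), Set.indicator_of_mem
              (by rwa [Metric.mem_ball, dist_comm, dist_eq_norm])]
          · rw [Set.indicator_of_notMem (by exact hk), Set.indicator_of_notMem
              (by rwa [Metric.mem_ball, dist_comm, dist_eq_norm])]
            simp
        · rw [Set.indicator_of_notMem (by exact hyT)]
          exact bot_le
    _ = ∑' k, ENNReal.ofReal (u k * (c / r k) ^ n) *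
          ∫⁻ y in Metric.ball x (2 * c * r k), ‖h y‖ₑ := by
        rw [lintegral_tsum fun k => (hh.enorm.indicator measurableSet_ball).const_mul _]
        refine tsum_congr fun k => ?_
        rw [lintegral_const_mul' _ _ ENNReal.ofReal_ne_top, lintegral_indicator measurableSet_ball]
    _ ≤ ∑' k, ENNReal.ofReal ((1 / 2) ^ k) *
          (ENNReal.ofReal (T * (2 * c * c) ^ n) * V * maximal h x) := by
        refine ENNReal.tsum_le_tsum fun k => ?_
        have hk0 := hr0 k
        grw [lintegral_ball_le_maximal h x (by positivity : 0 < 2 * c * r k)]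
        rw [← mul_assoc, ← mul_assoc, ← mul_assoc, ← mul_assoc, ← ENNReal.ofReal_mul (by positivity),
          ← ENNReal.ofReal_mul (by positivity)]
        refine le_of_eq ?_
        congr 3
        simp only [hu]
        have e : c / r k * (2 * c * r k) = 2 * c * c := by field_simp
        rw [← e, mul_pow (c / r k)]
        ring
    _ = _ := by
        rw [ENNReal.tsum_mul_right]
        have e1 : ∑' k : ℕ, ENNReal.ofReal ((1 / 2) ^ k) = 2 := by
          rw [← ENNReal.ofReal_tsum_of_nonneg (fun k => by positivity) summable_geometric_two,
            tsum_geometric_two]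
          simp
        have e2 : (kernelConst n γ : ℝ≥0∞) = 2 * ENNReal.ofReal ((2 * c * c) ^ n) * V := by
          have hVt : V ≠ ∞ := measure_ball_lt_top.ne
          rw [kernelConst, ENNReal.coe_mul, ENNReal.coe_mul, ENNReal.coe_toNNReal hVt,
            ENNReal.ofReal]
          congr 3
          ext
          rw [Real.coe_toNNReal _ (by positivity)]
          push_cast
          rw [hc]
        rw [e1, e2, ENNReal.ofReal_mul hT.le]
        ring

/-! ### The Lusin–Lipschitz inequality -/

theorem gradNorm_nonneg (f : Rn n → ℂ) (x : Rn n) : 0 ≤ gradNorm f x := Real.sqrt_nonneg _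

theorem continuous_gradNorm {f : Rn n → ℂ} (hf : ContDiff ℝ 1 f) : Continuous (gradNorm f) := by
  have := hf.continuous_fderiv (by norm_num)
  unfold gradNorm
  fun_prop

theorem norm_fderiv_apply_le (f : Rn n → ℂ) (x v : Rn n) :
    ‖fderiv ℝ f x v‖ ≤ gradNorm f x * ‖v‖ := by
  have hv : v = ∑ i, v i • EuclideanSpace.single i (1 : ℝ) := by
    ext j
    simp [Finset.sum_apply, Pi.single_apply]
  calc ‖fderiv ℝ f x v‖ = ‖∑ i, v i • fderiv ℝ f x (EuclideanSpace.single i 1)‖ := by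
        conv_lhs => rw [hv]
        simp only [map_sum, map_smul]
    _ ≤ ∑ i, ‖fderiv ℝ f x (EuclideanSpace.single i 1)‖ * ‖v i‖ := by
        refine (norm_sum_le _ _).trans (le_of_eq (Finset.sum_congr rfl fun i _ => ?_))
        rw [norm_smul, mul_comm]
    _ ≤ _ := by
        rw [gradNorm, EuclideanSpace.norm_eq]
        exact Real.sum_mul_le_sqrt_mul_sqrt _ _ _

theorem enorm_sub_le_lintegral_gradNorm {f : Rn n → ℂ} (hf : ContDiff ℝ 1 f) (x z : Rn n) :
    ‖f x - f z‖ₑ ≤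
      ENNReal.ofReal ‖z - x‖ * ∫⁻ s in Set.Ioc (0 : ℝ) 1, ‖gradNorm f (x + s • (z - x))‖ₑ := by
  have hd : ∀ s : ℝ, HasDerivAt (fun s : ℝ => f (x + s • (z - x)))
      (fderiv ℝ f (x + s • (z - x)) (z - x)) s := by
    intro s
    have h1 : HasDerivAt (fun s : ℝ => x + s • (z - x)) (z - x) s := by
      simpa using ((hasDerivAt_id s).smul_const (z - x)).const_add x
    exact ((hf.differentiable (by norm_num)) _).hasFDerivAt.comp_hasDerivAt s h1
  have hc : Continuous fun s : ℝ => fderiv ℝ f (x + s • (z - x)) (z - x) := by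
    have := hf.continuous_fderiv (by norm_num)
    fun_prop
  have hi := intervalIntegral.integral_eq_sub_of_hasDerivAt (a := 0) (b := 1)
    (fun s _ => hd s) (hc.intervalIntegrable _ _)
  simp only [one_smul, zero_smul, add_zero, add_sub_cancel] at hi
  rw [enorm_sub_rev, ← hi, intervalIntegral.integral_of_le zero_le_one]
  refine (enorm_integral_le_lintegral_enorm _).trans ?_
  rw [← lintegral_const_mul' _ _ ENNReal.ofReal_ne_top]
  refine lintegral_mono fun s => ?_
  rw [Real.enorm_of_nonneg (gradNorm_nonneg _ _), ← ENNReal.ofReal_mul (norm_nonneg _),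
    ← ofReal_norm, mul_comm]
  exact ENNReal.ofReal_le_ofReal (norm_fderiv_apply_le f _ _)

theorem setLIntegral_ball_homothety (g : Rn n → ℝ≥0∞) (hg : Measurable g) (x : Rn n) {d s : ℝ}
    (hs : 0 < s) :
    ∫⁻ z in Metric.ball x d, g (x + s • (z - x)) =
      ENNReal.ofReal (s ^ n)⁻¹ * ∫⁻ y in Metric.ball x (s * d), g y := by
  set F := (Metric.ball x (s * d)).indicator g with hF
  have mF : Measurable F := hg.indicator measurableSet_ball
  have e1 : ∀ z, (Metric.ball x d).indicator (fun z => g (x + s • (z - x))) z =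
      F (x + s • (z - x)) := by
    intro z
    have : z ∈ Metric.ball x d ↔ x + s • (z - x) ∈ Metric.ball x (s * d) := by
      rw [mem_ball_iff_norm, mem_ball_iff_norm, add_sub_cancel_left, norm_smul,
        Real.norm_of_nonneg hs.le, mul_lt_mul_iff_right₀ hs]
    by_cases hz : z ∈ Metric.ball x d
    · rw [Set.indicator_of_mem hz, hF, Set.indicator_of_mem (this.1 hz)]
    · rw [Set.indicator_of_notMem hz, hF, Set.indicator_of_notMem (mt this.2 hz)]
  rw [← lintegral_indicator measurableSet_ball, lintegral_congr e1,
    lintegral_sub_right_eq_self (fun w => F (x + s • w)) x,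
    ← lintegral_map (f := fun w => F (x + w)) (mF.comp (measurable_const_add x))
      (measurable_const_smul s),
    Measure.map_addHaar_smul volume hs.ne', lintegral_smul_measure,
    lintegral_add_left_eq_self F x, hF, lintegral_indicator measurableSet_ball,
    finrank_euclideanSpace_fin, abs_of_pos (by positivity), smul_eq_mul]

/-- Integrate the gradient along segments from `x` and exchange integrals. For fixed `s` the
homothety of ratio `s` has Jacobian factor `s⁻ⁿ`, which cancels the volume factor `sⁿ` of the
shrunken ball, so the bound is uniform in `s`. -/
theorem lintegral_ball_enorm_sub_le {f : Rn n → ℂ} (hf : ContDiff ℝ 1 f) (x : Rn n) {d : ℝ}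
    (hd : 0 < d) :
    ∫⁻ z in Metric.ball x d, ‖f x - f z‖ₑ ≤ ENNReal.ofReal d * (ENNReal.ofReal (d ^ n) *
      volume (Metric.ball (0 : Rn n) 1) * maximal (fun y => (gradNorm f y : ℂ)) x) := by
  have hc := continuous_gradNorm hf
  calc _ ≤ ∫⁻ z in Metric.ball x d, ENNReal.ofReal d *
        ∫⁻ s in Set.Ioc (0 : ℝ) 1, ‖gradNorm f (x + s • (z - x))‖ₑ := by
        refine setLIntegral_mono' measurableSet_ball fun z hz => ?_
        refine (enorm_sub_le_lintegral_gradNorm hf x z).trans ?_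
        gcongr
        exact (mem_ball_iff_norm.1 hz).le
    _ = ENNReal.ofReal d * ∫⁻ s in Set.Ioc (0 : ℝ) 1, ∫⁻ z in Metric.ball x d,
          ‖gradNorm f (x + s • (z - x))‖ₑ := by
        rw [lintegral_const_mul' _ _ ENNReal.ofReal_ne_top, lintegral_lintegral_swap]
        refine Measurable.aemeasurable ?_
        have : Continuous fun q : Rn n × ℝ => gradNorm f (x + q.2 • (q.1 - x)) := by fun_prop
        exact this.measurable.enorm
    _ ≤ ENNReal.ofReal d * ∫⁻ _ in Set.Ioc (0 : ℝ) 1, (ENNReal.ofReal (d ^ n) *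
          volume (Metric.ball (0 : Rn n) 1) * maximal (fun y => (gradNorm f y : ℂ)) x) := by
        refine mul_le_mul_right (setLIntegral_mono' measurableSet_Ioc fun s hs => ?_) _
        have hs0 : 0 < s := hs.1
        rw [setLIntegral_ball_homothety (fun y => ‖gradNorm f y‖ₑ) hc.measurable.enorm x hs0]
        have := lintegral_ball_le_maximal (fun y => (gradNorm f y : ℂ)) x (mul_pos hs0 hd)
        simp only [enorm_ofReal] at this
        refine (mul_le_mul_right this _).trans (le_of_eq ?_)
        rw [← mul_assoc, ← mul_assoc, ← ENNReal.ofReal_mul (by positivity)]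
        congr 3
        rw [mul_pow]
        field_simp
    _ = _ := by simp

/-- The Lusin–Lipschitz inequality. -/
theorem enorm_sub_le_maximal {f : Rn n → ℂ} (hf : ContDiff ℝ 1 f) {x y : Rn n} (hxy : x ≠ y) :
    ‖f x - f y‖ₑ ≤ ENNReal.ofReal (2 ^ n * ‖x - y‖) *
      (maximal (fun z => (gradNorm f z : ℂ)) x + maximal (fun z => (gradNorm f z : ℂ)) y) := by
  set d := ‖x - y‖ with hd
  have hd0 : 0 < d := norm_pos_iff.2 (sub_ne_zero.2 hxy)
  set m := maximal (fun z => (gradNorm f z : ℂ))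
  -- `f x` and `f y` are both compared with `f z`, averaged over a ball contained in both balls of
  -- radius `d`; its halved radius is the source of the factor `2 ^ n`.
  set B := Metric.ball (midpoint ℝ x y) (d / 2) with hB
  have hBx : B ⊆ Metric.ball x d := by
    refine Metric.ball_subset_ball' (le_of_eq ?_)
    rw [dist_midpoint_left, dist_eq_norm, ← hd]
    norm_num; ring
  have hBy : B ⊆ Metric.ball y d := by
    refine Metric.ball_subset_ball' (le_of_eq ?_)
    rw [dist_midpoint_right, dist_eq_norm, ← hd]
    norm_num; ring
  set V := volume (Metric.ball (0 : Rn n) 1)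
  have hV0 : V ≠ 0 := (Metric.measure_ball_pos volume _ one_pos).ne'
  have hVt : V ≠ ∞ := measure_ball_lt_top.ne
  have hvol : volume B = ENNReal.ofReal ((d / 2) ^ n) * V := by
    rw [hB, Measure.addHaar_ball_of_pos volume _ (by positivity), finrank_euclideanSpace_fin]
  have h1 : ‖f x - f y‖ₑ * volume B ≤ ENNReal.ofReal d * (ENNReal.ofReal (d ^ n) * V * m x) +
      ENNReal.ofReal d * (ENNReal.ofReal (d ^ n) * V * m y) := by
    calc ‖f x - f y‖ₑ * volume B = ∫⁻ _ in B, ‖f x - f y‖ₑ := by rw [setLIntegral_const]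
      _ ≤ ∫⁻ z in B, (‖f x - f z‖ₑ + ‖f y - f z‖ₑ) := by
          refine lintegral_mono fun z => ?_
          rw [enorm_sub_rev (f y)]
          refine le_trans (le_of_eq ?_) (enorm_add_le _ _)
          congr 1; ring
      _ = (∫⁻ z in B, ‖f x - f z‖ₑ) + ∫⁻ z in B, ‖f y - f z‖ₑ :=
          lintegral_add_left (measurable_const.sub hf.continuous.measurable).enorm _
      _ ≤ _ := add_le_add
          ((lintegral_mono_set hBx).trans (lintegral_ball_enorm_sub_le hf x hd0))
          ((lintegral_mono_set hBy).trans (lintegral_ball_enorm_sub_le hf y hd0))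
  have hB0 : volume B ≠ 0 := (Metric.measure_ball_pos volume _ (by positivity)).ne'
  have hBt : volume B ≠ ∞ := measure_ball_lt_top.ne
  rw [← ENNReal.mul_le_mul_iff_left hB0 hBt]
  refine h1.trans (le_of_eq ?_)
  have e : ENNReal.ofReal (2 ^ n * d) * ENNReal.ofReal ((d / 2) ^ n) =
      ENNReal.ofReal d * ENNReal.ofReal (d ^ n) := by
    rw [← ENNReal.ofReal_mul (by positivity), ← ENNReal.ofReal_mul (by positivity), div_pow]
    congr 1
    field_simp
  rw [hvol]
  calc _ = (ENNReal.ofReal d * ENNReal.ofReal (d ^ n)) * V * (m x + m y) := by ring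
    _ = _ := by rw [← e]; ring

/-- Compact support enters only here: it bounds the gradient, so the maximal function is finite at
every point and may be handled as a real number. -/
theorem maximal_gradNorm_lt_top {f : Rn n → ℂ} (hf : ContDiff ℝ 1 f)
    (hs : HasCompactSupport (gradNorm f)) (x : Rn n) :
    maximal (fun z => (gradNorm f z : ℂ)) x < ∞ := by
  obtain ⟨B, hB⟩ := hs.exists_bound_of_continuous (continuous_gradNorm hf)
  refine (maximal_le_of_bound (B := ENNReal.ofReal B) (fun z => ?_) x).trans_lt
    ENNReal.ofReal_lt_top
  rw [enorm_ofReal, ← ofReal_norm]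
  exact ENNReal.ofReal_le_ofReal (hB z)

/-! ### Comparison of kernels with different exponents -/

theorem lintegral_kernel_one_le (hn : 1 ≤ n) {γ T : ℝ} (hγ : γ ≠ 0) (hT : 0 ≤ T) (x : Rn n) :
    ∫⁻ y in {y | ‖x - y‖ ^ γ < T}, ENNReal.ofReal (‖x - y‖ ^ (γ - n)) ≤
      kernelConst n γ * ENNReal.ofReal T := by
  have h := lintegral_kernel_le hn hγ hT (h := fun _ => 1) aemeasurable_const x
  simp only [enorm_one, mul_one] at h
  refine h.trans (mul_le_of_le_one_right' (maximal_le_of_bound (by simp) x))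

/-- Among the sets with a given integral of `|x - y| ^ (γ - n)`, the sets `|x - y| ^ γ < T` nearly
minimize the integral of `|x - y| ^ (s * γ - n)`, `s ≥ 1`. -/
theorem lintegral_kernel_le_rpow (hn : 1 ≤ n) {γ s : ℝ} (hγ : γ ≠ 0) (hs : 1 ≤ s) (x : Rn n)
    {E : Set (Rn n)} (hE : MeasurableSet E) (hx : x ∉ E) :
    ∫⁻ y in E, ENNReal.ofReal (‖x - y‖ ^ (γ - n)) ≤ (kernelConst n γ + 1) *
      (∫⁻ y in E, ENNReal.ofReal (‖x - y‖ ^ (s * γ - n))) ^ (1 / s) := by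
  have hs0 : 0 < s := by linarith
  set I := ∫⁻ y in E, ENNReal.ofReal (‖x - y‖ ^ (s * γ - n)) with hI
  rcases eq_or_ne I ∞ with hIt | hIt
  · rw [hIt, ENNReal.top_rpow_of_pos (by positivity), ENNReal.mul_top (by positivity)]
    exact le_top
  have hS : ∀ T : ℝ, MeasurableSet {y : Rn n | ‖x - y‖ ^ γ < T} := fun T =>
    measurableSet_lt ((measurable_const.sub measurable_id).norm.pow_const γ) measurable_const
  -- Split `E` at `|x - y|^γ = T`. Below, the kernel has total mass at most a multiple of `T`;
  -- above, `(|x - y|^γ)^(1 - s)` is at most `T^(1 - s)` because `1 - s ≤ 0`.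
  have key : ∀ T : ℝ, 0 < T → ∫⁻ y in E, ENNReal.ofReal (‖x - y‖ ^ (γ - n)) ≤
      kernelConst n γ * ENNReal.ofReal T + ENNReal.ofReal (T ^ (1 - s)) * I := by
    intro T hT
    rw [← lintegral_inter_add_sdiff _ E (hS T)]
    refine add_le_add ((lintegral_mono_set Set.inter_subset_right).trans
      (lintegral_kernel_one_le hn hγ hT.le x)) ?_
    calc _ ≤ ∫⁻ y in E \ {y | ‖x - y‖ ^ γ < T},
          ENNReal.ofReal (T ^ (1 - s)) * ENNReal.ofReal (‖x - y‖ ^ (s * γ - n)) := by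
          refine setLIntegral_mono' (hE.diff (hS T)) fun y hy => ?_
          have hyx : x ≠ y := fun h => hx (h ▸ hy.1)
          have ht : 0 < ‖x - y‖ := norm_pos_iff.2 (sub_ne_zero.2 hyx)
          have hTy : T ≤ ‖x - y‖ ^ γ := not_lt.1 hy.2
          rw [← ENNReal.ofReal_mul (by positivity)]
          refine ENNReal.ofReal_le_ofReal ?_
          have e : ‖x - y‖ ^ (γ - n) = (‖x - y‖ ^ γ) ^ (1 - s) * ‖x - y‖ ^ (s * γ - n) := by
            rw [← Real.rpow_mul ht.le, ← Real.rpow_add ht]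
            ring_nf
          rw [e]
          exact mul_le_mul_of_nonneg_right
            (Real.rpow_le_rpow_of_nonpos hT hTy (by linarith)) (by positivity)
      _ ≤ _ := by
          rw [lintegral_const_mul' _ _ ENNReal.ofReal_ne_top]
          gcongr
          exact lintegral_mono_set Set.sdiff_subset
  rcases eq_or_ne I 0 with hI0 | hI0
  · rw [hI0, ENNReal.zero_rpow_of_pos (by positivity), mul_zero]
    simp only [hI0, mul_zero, add_zero] at key
    refine ge_of_tendsto (x := 𝓝[>] (0 : ℝ))
      (f := fun T => (kernelConst n γ : ℝ≥0∞) * ENNReal.ofReal T) ?_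
      (eventually_nhdsWithin_of_forall key)
    have : Tendsto (fun T : ℝ => (kernelConst n γ : ℝ≥0∞) * ENNReal.ofReal T) (𝓝 0)
        (𝓝 ((kernelConst n γ : ℝ≥0∞) * ENNReal.ofReal 0)) :=
      ENNReal.Tendsto.const_mul (ENNReal.continuous_ofReal.tendsto 0)
        (Or.inr ENNReal.coe_ne_top)
    simpa using this.mono_left nhdsWithin_le_nhds
  · set a := I.toReal with ha
    have ha0 : 0 < a := ENNReal.toReal_pos hI0 hIt
    have hIa : I = ENNReal.ofReal a := (ENNReal.ofReal_toReal hIt).symm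
    -- This `T` balances the two terms: `T^(1 - s) · a = T`. It would be zero for `I = 0`, a case
    -- settled above by letting `T` tend to zero.
    refine (key (a ^ (1 / s)) (by positivity)).trans (le_of_eq ?_)
    rw [hIa, ENNReal.ofReal_rpow_of_pos ha0, ← ENNReal.ofReal_mul (by positivity), add_mul, one_mul]
    congr 2
    rw [← Real.rpow_mul ha0.le]
    nth_rewrite 2 [← Real.rpow_one a]
    rw [← Real.rpow_add ha0]
    congr 1
    field_simp
    ring

/-! ### Level sets and their near and far parts -/

theorem setLIntegral_section {S : Set (Rn n × Rn n)} (hS : MeasurableSet S)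
    (F : Rn n × Rn n → ℝ≥0∞) (x : Rn n) :
    ∫⁻ y in {y | (x, y) ∈ S}, F (x, y) = ∫⁻ y, S.indicator F (x, y) := by
  have h : MeasurableSet {y | (x, y) ∈ S} := measurable_prodMk_left hS
  rw [← lintegral_indicator h]
  rfl

theorem measurableSet_diffSet {f : Rn n → ℂ} (hf : Continuous f) (l s : ℝ) :
    MeasurableSet (diffSet f l s) := by
  have h1 : Measurable fun z : Rn n × Rn n => ‖f z.1 - f z.2‖ / ‖z.1 - z.2‖ ^ (1 + s) :=
    ((hf.comp continuous_fst).sub (hf.comp continuous_snd)).norm.measurable.div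
      ((continuous_fst.sub continuous_snd).norm.measurable.pow_const _)
  exact (measurableSet_eq_fun measurable_fst measurable_snd).compl.inter
    (measurableSet_lt measurable_const h1)

/-- The function `x ↦ ∫ 1_{E_{l, s}[f]}(x, y) |x - y|^{γ - n} dy`. -/
noncomputable def levelIntegral (f : Rn n → ℂ) (l s γ : ℝ) (x : Rn n) : ℝ≥0∞ :=
  ∫⁻ y in {y | (x, y) ∈ diffSet f l s}, ENNReal.ofReal (‖x - y‖ ^ (γ - n))

theorem levelFunction_eq {f : Rn n → ℂ} (hf : Continuous f) (l γ q : ℝ) :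
    levelFunction f l γ q = fun x => levelIntegral f l (γ / q) γ x ^ (1 / q) := by
  ext x
  exact congrArg (· ^ (1 / q))
    (setLIntegral_section (measurableSet_diffSet hf l (γ / q)) _ x).symm

theorem measurable_levelIntegral {f : Rn n → ℂ} (hf : Continuous f) (l s γ : ℝ) :
    Measurable (levelIntegral f l s γ) := by
  have e : levelIntegral f l s γ = fun x => ∫⁻ y, (diffSet f l s).indicator
      (fun z => ENNReal.ofReal (‖z.1 - z.2‖ ^ (γ - n))) (x, y) := by
    ext x
    exact setLIntegral_section (measurableSet_diffSet hf l s)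
      (fun z => ENNReal.ofReal (‖z.1 - z.2‖ ^ (γ - n))) x
  rw [e]
  refine Measurable.lintegral_prod_right' (f := (diffSet f l s).indicator
      (fun z => ENNReal.ofReal (‖z.1 - z.2‖ ^ (γ - n)))) ?_
  refine Measurable.indicator ?_ (measurableSet_diffSet hf l s)
  exact ((continuous_fst.sub continuous_snd).norm.measurable.pow_const _).ennreal_ofReal

/-- The radius function `(2 ^ (n + 1) M(|∇f|) / l) ^ p` that controls the level sets. -/
noncomputable def radius (f : Rn n → ℂ) (l p : ℝ) (x : Rn n) : ℝ :=
  (2 ^ (n + 1) / l * (maximal (fun z => (gradNorm f z : ℂ)) x).toReal) ^ p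

theorem measurable_radius (f : Rn n → ℂ) (l p : ℝ) : Measurable (radius f l p) :=
  ((measurable_maximal _).ennreal_toReal.const_mul _).pow_const p

theorem radius_nonneg (f : Rn n → ℂ) {l : ℝ} (hl : 0 < l) (p : ℝ) (x : Rn n) :
    0 ≤ radius f l p x :=
  Real.rpow_nonneg (mul_nonneg (by positivity) ENNReal.toReal_nonneg) _

/-- The sum of the two maximal values in the Lusin–Lipschitz inequality is at most twice the larger
one, hence `2 ^ (n + 1)` in `radius`; raising to the power `p` turns `γ / p` into `γ`. -/
theorem lt_radius_of_mem_diffSet {f : Rn n → ℂ} (hf : ContDiff ℝ 1 f)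
    (hs : HasCompactSupport (gradNorm f)) {l p γ : ℝ} (hl : 0 < l) (hp : 0 < p) {x y : Rn n}
    (h : (x, y) ∈ diffSet f l (γ / p)) :
    ‖x - y‖ ^ γ < radius f l p x ∨ ‖x - y‖ ^ γ < radius f l p y := by
  obtain ⟨hxy, hlt⟩ := h
  simp only at hxy hlt
  set m := maximal (fun z => (gradNorm f z : ℂ))
  have hd : 0 < ‖x - y‖ := norm_pos_iff.2 (sub_ne_zero.2 hxy)
  have hx := (maximal_gradNorm_lt_top hf hs x).ne
  have hy := (maximal_gradNorm_lt_top hf hs y).ne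
  have h1 : ‖f x - f y‖ ≤ 2 ^ n * ‖x - y‖ * ((m x).toReal + (m y).toReal) := by
    have := ENNReal.toReal_mono (by finiteness) (enorm_sub_le_maximal hf hxy)
    rwa [toReal_enorm, ENNReal.toReal_mul, ENNReal.toReal_ofReal (by positivity),
      ENNReal.toReal_add hx hy] at this
  rw [lt_div_iff₀ (by positivity), Real.rpow_add hd, Real.rpow_one] at hlt
  have h2 : l * ‖x - y‖ ^ (γ / p) < 2 ^ n * ((m x).toReal + (m y).toReal) := by
    refine lt_of_mul_lt_mul_left ?_ hd.le
    linarith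
  have step : ∀ z, (m x).toReal + (m y).toReal ≤ 2 * (m z).toReal →
      ‖x - y‖ ^ γ < radius f l p z := by
    intro z hz
    have h3 : ‖x - y‖ ^ (γ / p) < 2 ^ (n + 1) / l * (m z).toReal := by
      rw [div_mul_eq_mul_div, lt_div_iff₀ hl, pow_succ]
      have : (2 : ℝ) ^ n * ((m x).toReal + (m y).toReal) ≤ 2 ^ n * (2 * (m z).toReal) := by gcongr
      linarith
    have h4 := Real.rpow_lt_rpow (by positivity) h3 hp
    rwa [← Real.rpow_mul hd.le, div_mul_cancel₀ _ hp.ne'] at h4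
  rcases le_total (m x).toReal (m y).toReal with hle | hle
  · exact Or.inr (step y (by linarith))
  · exact Or.inl (step x (by linarith))

/-- The part of the level integral that is controlled by the radius at the far point. -/
noncomputable def farIntegral (R : Rn n → ℝ) (γ : ℝ) (x : Rn n) : ℝ≥0∞ :=
  ∫⁻ y in {y | ‖x - y‖ ^ γ < R y}, ENNReal.ofReal (‖x - y‖ ^ (γ - n))

theorem measurableSet_far {R : Rn n → ℝ} (hR : Measurable R) (γ : ℝ) :
    MeasurableSet {z : Rn n × Rn n | ‖z.1 - z.2‖ ^ γ < R z.2} :=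
  measurableSet_lt ((continuous_fst.sub continuous_snd).norm.measurable.pow_const _)
    (hR.comp measurable_snd)

theorem measurable_far_indicator {R : Rn n → ℝ} (hR : Measurable R) (γ : ℝ) :
    Measurable ({z : Rn n × Rn n | ‖z.1 - z.2‖ ^ γ < R z.2}.indicator
      fun z => ENNReal.ofReal (‖z.1 - z.2‖ ^ (γ - n))) :=
  Measurable.indicator
    ((continuous_fst.sub continuous_snd).norm.measurable.pow_const _).ennreal_ofReal
    (measurableSet_far hR γ)

theorem farIntegral_eq {R : Rn n → ℝ} (hR : Measurable R) (γ : ℝ) (x : Rn n) :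
    farIntegral R γ x = ∫⁻ y, {z : Rn n × Rn n | ‖z.1 - z.2‖ ^ γ < R z.2}.indicator
      (fun z => ENNReal.ofReal (‖z.1 - z.2‖ ^ (γ - n))) (x, y) :=
  setLIntegral_section (measurableSet_far hR γ)
    (fun z => ENNReal.ofReal (‖z.1 - z.2‖ ^ (γ - n))) x

theorem measurable_farIntegral {R : Rn n → ℝ} (hR : Measurable R) (γ : ℝ) :
    Measurable (farIntegral R γ) := by
  rw [funext (farIntegral_eq hR γ)]
  exact (measurable_far_indicator hR γ).lintegral_prod_right'

/-- After Tonelli, `R y` is constant in the inner integral over `x`; the kernel is symmetric, so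
`lintegral_kernel_le` applies with centre `y`. -/
theorem lintegral_farIntegral_mul_le (hn : 1 ≤ n) {γ : ℝ} (hγ : γ ≠ 0) {R : Rn n → ℝ}
    (hR : Measurable R) (hR0 : ∀ x, 0 ≤ R x) {g : Rn n → ℂ} (hg : Measurable g) :
    ∫⁻ x, farIntegral R γ x * ‖g x‖ₑ ≤
      kernelConst n γ * ∫⁻ y, ENNReal.ofReal (R y) * maximal g y := by
  have hm := measurable_far_indicator (n := n) hR γ
  set k := {z : Rn n × Rn n | ‖z.1 - z.2‖ ^ γ < R z.2}.indicator
      fun z => ENNReal.ofReal (‖z.1 - z.2‖ ^ (γ - n)) with hk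
  calc _ = ∫⁻ x, ∫⁻ y, k (x, y) * ‖g x‖ₑ := by
        refine lintegral_congr fun x => ?_
        rw [farIntegral_eq hR, lintegral_mul_const' _ _ enorm_ne_top]
    _ = ∫⁻ y, ∫⁻ x, k (x, y) * ‖g x‖ₑ :=
        lintegral_lintegral_swap (hm.mul (hg.comp measurable_fst).enorm).aemeasurable
    _ ≤ ∫⁻ y, kernelConst n γ * (ENNReal.ofReal (R y) * maximal g y) := by
        refine lintegral_mono fun y => ?_
        have hS : MeasurableSet {x : Rn n | ‖y - x‖ ^ γ < R y} :=
          measurableSet_lt ((measurable_const.sub measurable_id).norm.pow_const γ) measurable_const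
        have := lintegral_kernel_le hn hγ (hR0 y) hg.aemeasurable y
        rw [← mul_assoc]
        refine le_trans (le_of_eq ?_) this
        rw [← lintegral_indicator hS]
        refine lintegral_congr fun x => ?_
        by_cases hx : ‖x - y‖ ^ γ < R y
        · rw [hk, Set.indicator_of_mem (by exact hx), Set.indicator_of_mem
            (by rw [norm_sub_rev] at hx; exact hx), norm_sub_rev]
        · rw [hk, Set.indicator_of_notMem (by exact hx), Set.indicator_of_notMem
            (by rw [norm_sub_rev] at hx; exact hx), zero_mul]
    _ = _ := lintegral_const_mul' _ _ ENNReal.coe_ne_top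

theorem levelIntegral_le (hn : 1 ≤ n) {f : Rn n → ℂ} (hf : ContDiff ℝ 1 f)
    (hs : HasCompactSupport (gradNorm f)) {l p γ : ℝ} (hl : 0 < l) (hp : 0 < p) (hγ : γ ≠ 0)
    (x : Rn n) :
    levelIntegral f l (γ / p) γ x ≤
      kernelConst n γ * ENNReal.ofReal (radius f l p x) + farIntegral (radius f l p) γ x := by
  calc _ ≤ ∫⁻ y in {y | ‖x - y‖ ^ γ < radius f l p x} ∪ {y | ‖x - y‖ ^ γ < radius f l p y},
        ENNReal.ofReal (‖x - y‖ ^ (γ - n)) :=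
        lintegral_mono_set fun y hy => lt_radius_of_mem_diffSet hf hs hl hp hy
    _ ≤ _ := lintegral_union_le _ _ _
    _ ≤ _ := by
        refine add_le_add_left ?_ _
        exact lintegral_kernel_one_le hn hγ (radius_nonneg f hl p x) x

/-! ### Norm estimates -/

theorem IsBallQuasiBanach.extNorm_radius_le (hρ : IsBallQuasiBanach ρ) {p : ℝ} (hp : 0 < p)
    {f : Rn n → ℂ} (hf : ContDiff ℝ 1 f) (hs : HasCompactSupport (gradNorm f)) {l : ℝ}
    (hl : 0 < l) (hfin : ρ (fun x => (gradNorm f x : ℂ)) < ∞) :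
    extNorm (convexification ρ (1 / p)) (fun x => ENNReal.ofReal (radius f l p x)) ≤
      (ENNReal.ofReal (2 ^ (n + 1) / l) *
        (maximalOpNorm ρ * ρ (fun x => (gradNorm f x : ℂ)))) ^ p := by
  rw [extNorm_convexification hp]
  refine ENNReal.rpow_le_rpow ?_ hp.le
  have hc : 0 ≤ 2 ^ (n + 1) / l := by positivity
  have e : (fun x => ENNReal.ofReal (radius f l p x) ^ (1 / p)) = fun x =>
      ((2 ^ (n + 1) / l).toNNReal : ℝ≥0∞) * maximal (fun z => (gradNorm f z : ℂ)) x := by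
    ext x
    rw [ENNReal.ofReal_rpow_of_nonneg (radius_nonneg f hl p x) (by positivity), radius,
      ← Real.rpow_mul (mul_nonneg hc ENNReal.toReal_nonneg), mul_one_div_cancel hp.ne',
      Real.rpow_one, ENNReal.ofReal_mul hc,
      ENNReal.ofReal_toReal (maximal_gradNorm_lt_top hf hs x).ne]
    rfl
  rw [e]
  refine (hρ.extNorm_const_mul _ (measurable_maximal _).aemeasurable).trans ?_
  refine mul_le_mul_right (hρ.extNorm_maximal_le_mul ?_ hfin) _
  exact aemeasurable_ofReal (continuous_gradNorm hf).measurable.aemeasurable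

theorem extNorm_levelIntegral_le (hn : 1 ≤ n) {p γ : ℝ} (hp : 0 < p) (hγ : γ ≠ 0)
    (hρ : IsBallQuasiBanach ρ) (hρp : IsBallBanach (convexification ρ (1 / p)))
    (h1 : maximalOpNorm ρ < ∞)
    (h2 : maximalOpNorm (associate (convexification ρ (1 / p))) < ∞) {f : Rn n → ℂ}
    (hf : ContDiff ℝ 1 f) (hs : HasCompactSupport (gradNorm f)) {l : ℝ} (hl : 0 < l)
    (hfin : ρ (fun x => (gradNorm f x : ℂ)) < ∞) :
    extNorm (convexification ρ (1 / p)) (levelIntegral f l (γ / p) γ) ≤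
      kernelConst n γ * (1 + maximalOpNorm (associate (convexification ρ (1 / p)))) *
      (ENNReal.ofReal (2 ^ (n + 1) / l) *
        (maximalOpNorm ρ * ρ (fun x => (gradNorm f x : ℂ)))) ^ p := by
  have hrad := hρ.extNorm_radius_le hp hf hs hl hfin
  set N := maximalOpNorm (associate (convexification ρ (1 / p)))
  set B := (ENNReal.ofReal (2 ^ (n + 1) / l) *
        (maximalOpNorm ρ * ρ (fun x => (gradNorm f x : ℂ)))) ^ p with hB
  have hBt : B < ∞ := ENNReal.rpow_lt_top_of_nonneg hp.le (by finiteness)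
  have mR := measurable_radius f l p
  have mR' : AEMeasurable (fun x => ENNReal.ofReal (radius f l p x)) volume :=
    mR.ennreal_ofReal.aemeasurable
  have mK := (measurable_farIntegral mR γ).aemeasurable (μ := volume)
  have hfar : extNorm (convexification ρ (1 / p)) (farIntegral (radius f l p) γ) ≤
      kernelConst n γ * (B * N) := by
    -- Duality moves the maximal operator onto the test function `g`, where its boundedness on the
    -- associate space is available.
    refine hρp.extNorm_le_of_associate mK fun g hg hg1 => ?_
    have mg : Measurable fun x => (g x : ℂ) := Complex.measurable_ofReal.comp hg
    have hM := extNorm_maximal_le mg.aemeasurable hg1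
    have := lintegral_farIntegral_mul_le hn hγ mR (radius_nonneg f hl p) mg
    simp only [enorm_ofReal] at this
    refine this.trans (mul_le_mul_right ?_ _)
    refine (hρp.lintegral_mul_le_extNorm mR' (hrad.trans_lt hBt)
      (ae_lt_top_of_extNorm (hM.trans_lt h2))).trans ?_
    gcongr
  calc _ ≤ extNorm (convexification ρ (1 / p)) (fun x =>
        kernelConst n γ * ENNReal.ofReal (radius f l p x) + farIntegral (radius f l p) γ x) :=
        hρp.extNorm_mono (measurable_levelIntegral hf.continuous _ _ _).aemeasurable
          ((mR'.const_mul _).add mK)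
          (Eventually.of_forall (levelIntegral_le hn hf hs hl hp hγ))
    _ ≤ _ := hρp.extNorm_add (mR'.const_mul _) mK
    _ ≤ kernelConst n γ * B + kernelConst n γ * (B * N) :=
        add_le_add ((hρp.extNorm_const_mul _ mR').trans (mul_le_mul_right hrad _)) hfar
    _ = _ := by ring

/-- Since `(p / q * γ) / p = γ / q`, both sides involve the same level set; the kernel comparison
with `s = p / q` is applied to its section at `x`. -/
theorem levelFunction_le (hn : 1 ≤ n) {p q γ : ℝ} (hq : 0 < q) (hqp : q ≤ p) (hγ : γ ≠ 0)
    {f : Rn n → ℂ} (hf : Continuous f) (l : ℝ) (x : Rn n) :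
    levelFunction f l γ q x ≤ (((kernelConst n γ + 1) ^ (1 / q) : ℝ≥0) : ℝ≥0∞) *
      levelFunction f l (p / q * γ) p x := by
  have hp : 0 < p := hq.trans_le hqp
  have e : p / q * γ / p = γ / q := by field_simp
  rw [levelFunction_eq hf, levelFunction_eq hf, e]
  dsimp only
  have h := lintegral_kernel_le_rpow hn hγ ((one_le_div hq).2 hqp) x
    (measurable_prodMk_left (measurableSet_diffSet hf l (γ / q))) (fun h => h.1 rfl)
  refine (ENNReal.rpow_le_rpow h (by positivity : 0 ≤ 1 / q)).trans (le_of_eq ?_)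
  rw [ENNReal.mul_rpow_of_nonneg _ _ (by positivity), ← ENNReal.rpow_mul,
    ENNReal.coe_rpow_of_nonneg _ (by positivity)]
  congr 2
  · field_simp

theorem mul_extNorm_levelFunction_le (hn : 1 ≤ n) {p q γ : ℝ} (hq : 0 < q) (hqp : q ≤ p)
    (hγ : γ ≠ 0) (hρ : IsBallQuasiBanach ρ) (hρp : IsBallBanach (convexification ρ (1 / p)))
    (h1 : maximalOpNorm ρ < ∞)
    (h2 : maximalOpNorm (associate (convexification ρ (1 / p))) < ∞) {f : Rn n → ℂ}
    (hf : ContDiff ℝ 1 f) (hs : HasCompactSupport (gradNorm f)) {l : ℝ} (hl : 0 < l)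
    (hfin : ρ (fun x => (gradNorm f x : ℂ)) < ∞) :
    ENNReal.ofReal l * extNorm ρ (levelFunction f l γ q) ≤
      (((kernelConst n γ + 1) ^ (1 / q) : ℝ≥0) : ℝ≥0∞) *
      ((kernelConst n (p / q * γ) *
        (1 + maximalOpNorm (associate (convexification ρ (1 / p))))) ^ (1 / p) *
        (2 ^ (n + 1) * (maximalOpNorm ρ * ρ (fun x => (gradNorm f x : ℂ))))) := by
  have hp : 0 < p := hq.trans_le hqp
  have hγ' : p / q * γ ≠ 0 := mul_ne_zero (div_pos hp hq).ne' hγ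
  have meas : ∀ γ q : ℝ, AEMeasurable (levelFunction f l γ q) volume := fun γ q => by
    rw [levelFunction_eq hf.continuous]
    exact ((measurable_levelIntegral hf.continuous _ _ _).pow_const _).aemeasurable
  have e : extNorm ρ (levelFunction f l (p / q * γ) p) = extNorm (convexification ρ (1 / p))
      (levelIntegral f l (p / q * γ / p) (p / q * γ)) ^ (1 / p) := by
    rw [extNorm_convexification hp, ← ENNReal.rpow_mul, mul_one_div_cancel hp.ne',
      ENNReal.rpow_one, levelFunction_eq hf.continuous]
  have key := extNorm_levelIntegral_le hn hp hγ' hρ hρp h1 h2 hf hs hl hfin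
  have key' := ENNReal.rpow_le_rpow key (by positivity : 0 ≤ 1 / p)
  rw [← e, ENNReal.mul_rpow_of_nonneg _ _ (by positivity), ← ENNReal.rpow_mul,
    mul_one_div_cancel hp.ne', ENNReal.rpow_one] at key'
  have hmain : extNorm ρ (levelFunction f l γ q) ≤
      (((kernelConst n γ + 1) ^ (1 / q) : ℝ≥0) : ℝ≥0∞) *
        extNorm ρ (levelFunction f l (p / q * γ) p) :=
    (hρ.extNorm_mono (meas _ _) ((meas _ _).const_mul _)
      (Eventually.of_forall (levelFunction_le hn hq hqp hγ hf.continuous l))).trans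
      (hρ.extNorm_const_mul _ (meas _ _))
  grw [hmain, key']
  have e2 : ENNReal.ofReal l * ENNReal.ofReal (2 ^ (n + 1) / l) = 2 ^ (n + 1) := by
    rw [← ENNReal.ofReal_mul hl.le, mul_div_cancel₀ _ hl.ne', ENNReal.ofReal_pow (by norm_num)]
    simp
  rw [← e2]
  refine le_of_eq ?_
  ring

end BallSpace

/-! ### The constant and the conclusion -/

theorem mainTheorem3 (n : ℕ) (hn : 1 ≤ n) (p q γ : ℝ) (hp : 1 ≤ p) (hq : 0 < q) (hqp : q ≤ p)
    (hγ : γ ≠ 0) :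
    ∃ C : ℝ≥0 → ℝ≥0 → ℝ≥0,
      (∀ a b, 0 < C a b) ∧
      Continuous (Function.uncurry C) ∧
      (∀ b, StrictMono (fun a => C a b)) ∧
      (∀ a, StrictMono (fun b => C a b)) ∧
      ∀ ρ : (BallSpace.Rn n → ℂ) → ℝ≥0∞,
        BallSpace.IsBallBanach ρ →
        BallSpace.IsBallBanach (BallSpace.convexification ρ (1 / p)) →
        BallSpace.maximalOpNorm ρ < ∞ →
        BallSpace.maximalOpNorm
          (BallSpace.associate (BallSpace.convexification ρ (1 / p))) < ∞ →
        ∀ f : BallSpace.Rn n → ℂ, ContDiff ℝ 1 f → HasCompactSupport (BallSpace.gradNorm f) →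
          ⨆ (l : ℝ) (_ : 0 < l),
              ENNReal.ofReal l * BallSpace.extNorm ρ (BallSpace.levelFunction f l γ q) ≤
            C (BallSpace.maximalOpNorm ρ).toNNReal
                (BallSpace.maximalOpNorm
                  (BallSpace.associate (BallSpace.convexification ρ (1 / p)))).toNNReal *
              ρ (fun x => (BallSpace.gradNorm f x : ℂ)) := by
  have hp0 : 0 < p := by linarith
  have hpi : 0 < 1 / p := by positivity
  set c : ℝ≥0 := (BallSpace.kernelConst n γ + 1) ^ (1 / q) * 2 ^ (n + 1) with hc
  set k : ℝ≥0 := BallSpace.kernelConst n (p / q * γ) + 1 with hk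
  have hc0 : 0 < c := by positivity
  have hk0 : 0 < k := by positivity
  -- The estimate yields a factor `a`; `1 + a` keeps the constant positive at `a = 0`. The `1` added
  -- in `k` makes its positivity immediate.
  refine ⟨fun a b => c * (k * (1 + b)) ^ (1 / p) * (1 + a), fun a b => by positivity, ?_, ?_, ?_,
    ?_⟩
  · have h : Continuous fun z : ℝ≥0 × ℝ≥0 => (k * (1 + z.2)) ^ (1 / p) :=
      (NNReal.continuous_rpow_const hpi.le).comp (by fun_prop)
    exact (continuous_const.mul h).mul (by fun_prop)
  · intro b a a' haa'
    dsimp only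
    gcongr
  · intro a b b' hbb'
    have : (k * (1 + b)) ^ (1 / p) < (k * (1 + b')) ^ (1 / p) :=
      NNReal.rpow_lt_rpow (by gcongr) hpi
    dsimp only
    gcongr
  · intro ρ hρ hρp h1 h2 f hf hs
    refine iSup_le fun l => iSup_le fun hl => ?_
    by_cases hfin : ρ (fun x => (BallSpace.gradNorm f x : ℂ)) < ∞
    swap
    -- If the gradient has infinite norm, positivity of the constant makes the right-hand side
    -- infinite.
    · rw [not_lt_top_iff.1 hfin, ENNReal.mul_top
        (by rw [ENNReal.coe_ne_zero]; positivity)]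
      exact le_top
    refine (BallSpace.mul_extNorm_levelFunction_le hn hq hqp hγ hρ.toIsBallQuasiBanach hρp h1 h2
      hf hs hl hfin).trans ?_
    lift BallSpace.maximalOpNorm ρ to ℝ≥0 using h1.ne with a
    lift BallSpace.maximalOpNorm
      (BallSpace.associate (BallSpace.convexification ρ (1 / p))) to ℝ≥0 using h2.ne with b
    simp only [ENNReal.toNNReal_coe]
    have e : ((c * (k * (1 + b)) ^ (1 / p) * (1 + a) : ℝ≥0) : ℝ≥0∞) =
        (((BallSpace.kernelConst n γ + 1) ^ (1 / q) : ℝ≥0) : ℝ≥0∞) * 2 ^ (n + 1) *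
        ((k : ℝ≥0∞) * (1 + b)) ^ (1 / p) * (1 + a) := by
      rw [ENNReal.coe_mul, ENNReal.coe_mul, ENNReal.coe_rpow_of_nonneg _ hpi.le, hc,
        ENNReal.coe_mul]
      push_cast
      rfl
    rw [e]
    have hkk : (BallSpace.kernelConst n (p / q * γ) : ℝ≥0∞) ≤ k := by
      rw [hk]; exact_mod_cast le_self_add
    have ha : (a : ℝ≥0∞) ≤ 1 + a := le_add_self
    grw [hkk, ← ha]
    refine le_of_eq ?_
    ring
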